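/- **Theorem (Oracle CIs on the estimated support).** Let $(I,X,Y)$ and $(\tilde I,\tilde X)$ be random vectors, $I,\tilde I\in\mathbb R^m$, $X,\tilde X\in\mathbb R^d$, $Y\in\mathbb R$ ($m,d$ fixed), with $\mathbb E\|X\|^2<\infty$ and finite fourth moments of $I,Y,\tilde I,\tilde X$, and let $\beta^*\in\mathbb R^d$, $\epsilon:=Y-X^\top\beta^*$, be such that $\operatorname{Cov}(\tilde I,\tilde X)=\operatorname{Cov}(I,X)$ and $\mathbb E[\epsilon\mid I]=0$. Let $(I_i,Y_i)_{i\ge1}$ and $(\tilde I_j,\tilde X_j)_{j\ge1}$ be i.i.d. copies of $(I,Y)$ and $(\tilde I,\tilde X)$, the two sequences being independent of each other. Let the sample sizes satisfy $n,\tilde n\to\infty$, $N:=n+\tilde n$, $n/N\to\tau\in(0,1)$, $\tilde n/N\to\tilde\tau\in(0,1)$. The variables are centred in one of two ways: either $I,Y,\tilde I,\tilde X$ have mean zero and the data are used as they are, or the data are centred by subtracting their sample means. With the data so centred, put $\widehat{\operatorname{Cov}}(I,Y)=\frac1n\sum_{i\le n}I_iY_i$, $\widehat{\operatorname{Cov}}(\tilde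 I,\tilde X)=\frac1{\tilde n}\sum_{j\le\tilde n}\tilde I_j\tilde X_j^\top$ and $\hat g_N(\beta)=\widehat{\operatorname{Cov}}(I,Y)-\widehat{\operatorname{Cov}}(\tilde I,\tilde X)\beta$. Let $\Omega:=\tau^{-1}\operatorname{Var}(IY)+\tilde\tau^{-1}\operatorname{Var}(\tilde I\tilde X^\top\beta^*)$, where $I,Y,\tilde I,\tilde X$ stand for the variables minus their expectations. Let $S^*=\operatorname{supp}(\beta^*)$ and $s^*=|S^*|$. Let $W_N$ be (random) positive definite $m\times m$ matrices with $W_N\overset{p}{\to}W_0\succ0$, and assume the restricted eigenvalue condition: there is $\kappa>0$ such that for all $S\subseteq[d]$ with $|S|=s^*$ and all $\Delta\ne0$ with $\|\Delta_{S^c}\|_1\le3\|\Delta_S\|_1$, $$\kappa\le\frac{(\operatorname{Cov}(\tilde I,\tilde X)\Delta)^\top W_0\,(\operatorname{Cov}(\tilde I,\tilde X)\Delta)}{\|\Delta\|_2^2}.$$ Let $\lambda_N>0$ with $\lambda_N\asymp N^{-1/2}$, let $\hat\beta^{L}$ be a (measurable) minimizer over $\mathbb R^d$ of $\frac12\|W_N^{1/2}\hat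 g_N(\beta)\|_2^2+\lambda_N\|\beta\|_1$, let $c>0$ satisfy $|\beta^*_j|\ge c$ for all $j\in S^*$ (beta-min), and put $\widehat S=\{j:|\hat\beta^{L}_j|\ge c/2\}$. Let $W'_N$ be a second sequence of (random) positive definite matrices with $W'_N\overset{p}{\to}W'_0\succ0$, and let $\hat\beta$ be a (measurable) minimizer of $\hat g_N(\beta)^\top W'_N\hat g_N(\beta)$ over all $\beta\in\mathbb R^d$ with $\beta_{\widehat S^c}=0$. For a matrix $C\in\mathbb R^{m\times d}$, $W,O\in\mathbb R^{m\times m}$ and $S\subseteq[d]$ let $$V_S(C,W,O)=(C_S^\top WC_S)^{-1}\,(C_S^\top WOWC_S)\,(C_S^\top WC_S)^{-1},$$ where $C_S$ consists of the columns of $C$ in $S$, and let $V_{S^*}=V_{S^*}(\operatorname{Cov}(I,X),W'_0,\Omega)$. Then: 1. $\sqrt N(\hat\beta-\beta^*)\overset{d}{\to}\mathcal N(0,\tilde V)$, where $\tilde V\in\mathbb R^{d\times d}$ has the $S^*\times S^*$ block $V_{S^*}$ and is zero elsewhere. 2. Wald intervals are asymptotically valid: let $\widehat V\in\mathbb R^{d\times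 d}$ have the $\widehat S\times\widehat S$ block $V_{\widehat S}(\widehat{\operatorname{Cov}}(\tilde I,\tilde X),W'_N,\widehat\Omega)$ and be zero elsewhere, where $\widehat\Omega=\frac Nn\widehat\Omega_m+\frac N{\tilde n}\widehat\Omega_c$ and $\widehat\Omega_m,\widehat\Omega_c$ are the empirical covariance matrices of the (centred) products $I_iY_i$, $i\le n$, and $\tilde I_j\tilde X_j^\top\hat\beta$, $j\le\tilde n$. Then for every $\alpha\in(0,1)$ and every $j$ with $\tilde V_{jj}>0$, $$\mathbb P\Big(\beta^*_j\in\Big[\hat\beta_j-z_{1-\alpha/2}\sqrt{\widehat V_{jj}/N},\ \hat\beta_j+z_{1-\alpha/2}\sqrt{\widehat V_{jj}/N}\Big]\Big)\to1-\alpha,$$ where $z_{1-\alpha/2}$ is the $(1-\alpha/2)$-quantile of $\mathcal N(0,1)$. -/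

import Mathlib

open MeasureTheory ProbabilityTheory Filter Topology Matrix

namespace UnpairedIV

noncomputable section

/-! ### Population quantities -/

/-- The cross-covariance matrix `Cov(A, B)` of two random vectors. -/
def crossCov {Ω : Type*} [MeasurableSpace Ω] (P : Measure Ω) {p q : ℕ}
    (A : Ω → Fin p → ℝ) (B : Ω → Fin q → ℝ) : Matrix (Fin p) (Fin q) ℝ :=
  Matrix.of fun i j => cov[fun ω => A ω i, fun ω => B ω j; P]

/-- The product `(b - E b) (A - E A)` of a centred random scalar and a centred random vector;
for mean-zero variables this is `A b`. -/
def centeredProduct {Ω : Type*} [MeasurableSpace Ω] (P : Measure Ω) {p : ℕ}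
    (A : Ω → Fin p → ℝ) (b : Ω → ℝ) : Ω → Fin p → ℝ :=
  fun ω i => (b ω - ∫ ω', b ω' ∂P) * (A ω i - ∫ ω', A ω' i ∂P)

/-- The moment variance `Ω = τ⁻¹ Var(I Y) + τt⁻¹ Var(It Xtᵀ β)` (centred variables), the limit of
the variance of `√N ĝ_N(β)`. -/
def momentVar {Ω : Type*} [MeasurableSpace Ω] (P : Measure Ω) {m d : ℕ} (τ τt : ℝ)
    (I : Ω → Fin m → ℝ) (Y : Ω → ℝ) (It : Ω → Fin m → ℝ) (Xt : Ω → Fin d → ℝ)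
    (β : Fin d → ℝ) : Matrix (Fin m) (Fin m) ℝ :=
  τ⁻¹ • crossCov P (centeredProduct P I Y) (centeredProduct P I Y) +
    τt⁻¹ • crossCov P (centeredProduct P It fun ω => Xt ω ⬝ᵥ β)
      (centeredProduct P It fun ω => Xt ω ⬝ᵥ β)

/-- The support of a coefficient vector. -/
def supp {d : ℕ} (β : Fin d → ℝ) : Finset (Fin d) :=
  Finset.univ.filter fun j => β j ≠ 0

/-- The restricted eigenvalue condition at sparsity `s`: a uniform `κ > 0` bounds from below the
ratio `‖C Δ‖²_W / ‖Δ‖₂²`, where `‖a‖²_W = aᵀ W a`, over all nonzero `Δ` in the cone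
`‖Δ_{Sᶜ}‖₁ ≤ 3 ‖Δ_S‖₁`, for every `S` with `|S| = s`. -/
def RestrictedEigenvalue {m d : ℕ} (C : Matrix (Fin m) (Fin d) ℝ) (W : Matrix (Fin m) (Fin m) ℝ)
    (s : ℕ) : Prop :=
  ∃ κ : ℝ, 0 < κ ∧ ∀ S : Finset (Fin d), S.card = s → ∀ Δ : Fin d → ℝ, Δ ≠ 0 →
    ∑ j ∈ Sᶜ, |Δ j| ≤ 3 * ∑ j ∈ S, |Δ j| →
      κ ≤ ((C *ᵥ Δ) ⬝ᵥ (W *ᵥ (C *ᵥ Δ))) / ∑ j, Δ j ^ 2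

/-- The columns of `C` with index in `S`. -/
def cols {m d : ℕ} (C : Matrix (Fin m) (Fin d) ℝ) (S : Finset (Fin d)) :
    Matrix (Fin m) S ℝ :=
  C.submatrix id Subtype.val

/-- The sandwich covariance `(C_Sᵀ W C_S)⁻¹ (C_Sᵀ W O W C_S) (C_Sᵀ W C_S)⁻¹`. -/
def sandwich {m d : ℕ} (C : Matrix (Fin m) (Fin d) ℝ) (W O : Matrix (Fin m) (Fin m) ℝ)
    (S : Finset (Fin d)) : Matrix S S ℝ :=
  ((cols C S)ᵀ * W * cols C S)⁻¹ * ((cols C S)ᵀ * W * O * W * cols C S) *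
    ((cols C S)ᵀ * W * cols C S)⁻¹

/-- The `d × d` matrix whose `S × S` block is `V` and which is zero elsewhere. -/
def embedBlock {d : ℕ} (S : Finset (Fin d)) (V : Matrix S S ℝ) : Matrix (Fin d) (Fin d) ℝ :=
  Matrix.of fun i j => if h : i ∈ S ∧ j ∈ S then V ⟨i, h.1⟩ ⟨j, h.2⟩ else 0

/-! ### Sample quantities (functions of the realized data) -/

/-- How the data are centred: `population` means that the variables have population mean zero and
are used as they are, `sample` that the sample mean is subtracted. -/
inductive Centering
  | population
  | sample

/-- The average of the first `n` terms. -/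
def avg {E : Type*} [AddCommGroup E] [Module ℝ E] (n : ℕ) (v : ℕ → E) : E :=
  (n : ℝ)⁻¹ • ∑ i ∈ Finset.range n, v i

/-- The vector that the centring convention subtracts from the first `n` data points. -/
def Centering.shift {E : Type*} [AddCommGroup E] [Module ℝ E] (c : Centering) (n : ℕ)
    (v : ℕ → E) : E :=
  match c with
  | .population => 0
  | .sample => avg n v

/-- The summands `A_i b_i` of the sample covariances, for data centred by the convention `c`. -/
def sampleProduct {p : ℕ} (c : Centering) (n : ℕ) (A : ℕ → Fin p → ℝ) (b : ℕ → ℝ) :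
    ℕ → Fin p → ℝ :=
  fun i => (b i - c.shift n b) • (A i - c.shift n A)

/-- The sample covariance `n⁻¹ ∑ A_i b_i` of a vector and a scalar. -/
def sampleCovVec {p : ℕ} (c : Centering) (n : ℕ) (A : ℕ → Fin p → ℝ) (b : ℕ → ℝ) : Fin p → ℝ :=
  avg n (sampleProduct c n A b)

/-- The sample cross-covariance `n⁻¹ ∑ A_i B_iᵀ`. -/
def sampleCovMat {p q : ℕ} (c : Centering) (n : ℕ) (A : ℕ → Fin p → ℝ) (B : ℕ → Fin q → ℝ) :
    Matrix (Fin p) (Fin q) ℝ :=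
  Matrix.of fun i j => sampleCovVec c n A (fun k => B k j) i

/-- The empirical covariance matrix `n⁻¹ ∑ (z_i - z̄)(z_i - z̄)ᵀ`. -/
def sampleVar {p : ℕ} (n : ℕ) (z : ℕ → Fin p → ℝ) : Matrix (Fin p) (Fin p) ℝ :=
  avg n fun i => Matrix.vecMulVec (z i - avg n z) (z i - avg n z)

/-- The sample version of `momentVar`, with `τ, τt` replaced by `n / N, nt / N`, `N = n + nt`. -/
def sampleMomentVar {m d : ℕ} (c : Centering) (n nt : ℕ) (I : ℕ → Fin m → ℝ) (Y : ℕ → ℝ)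
    (It : ℕ → Fin m → ℝ) (Xt : ℕ → Fin d → ℝ) (b : Fin d → ℝ) : Matrix (Fin m) (Fin m) ℝ :=
  ((n : ℝ) / ((n + nt : ℕ) : ℝ))⁻¹ • sampleVar n (sampleProduct c n I Y) +
    ((nt : ℝ) / ((n + nt : ℕ) : ℝ))⁻¹ •
      sampleVar nt (sampleProduct c nt It fun j => Xt j ⬝ᵥ b)

/-! ### Estimators -/

/-- The GMM criterion `ĝ(β)ᵀ W ĝ(β) = ‖W^{1/2} ĝ(β)‖₂²` with `ĝ(β) = a - B β`. -/
def gmmObjective {m d : ℕ} (W : Matrix (Fin m) (Fin m) ℝ) (a : Fin m → ℝ)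
    (B : Matrix (Fin m) (Fin d) ℝ) (β : Fin d → ℝ) : ℝ :=
  (a - B *ᵥ β) ⬝ᵥ (W *ᵥ (a - B *ᵥ β))

/-- `b` minimizes the `ℓ¹`-penalized criterion `½ ‖W^{1/2} ĝ(β)‖₂² + lam ‖β‖₁` over `ℝ^d`. -/
def IsLassoGMM {m d : ℕ} (W : Matrix (Fin m) (Fin m) ℝ) (a : Fin m → ℝ)
    (B : Matrix (Fin m) (Fin d) ℝ) (lam : ℝ) (b : Fin d → ℝ) : Prop :=
  ∀ β : Fin d → ℝ, 1 / 2 * gmmObjective W a B b + lam * ∑ j, |b j| ≤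
    1 / 2 * gmmObjective W a B β + lam * ∑ j, |β j|

/-- The selected support `{j : |b_j| ≥ c / 2}`. -/
def selected {d : ℕ} (c : ℝ) (b : Fin d → ℝ) : Finset (Fin d) :=
  Finset.univ.filter fun j => c / 2 ≤ |b j|

/-- `b` minimizes the GMM criterion over all `β` that vanish off `S`. -/
def IsRefitGMM {m d : ℕ} (W : Matrix (Fin m) (Fin m) ℝ) (a : Fin m → ℝ)
    (B : Matrix (Fin m) (Fin d) ℝ) (S : Finset (Fin d)) (b : Fin d → ℝ) : Prop :=
  (∀ j, j ∉ S → b j = 0) ∧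
    ∀ β : Fin d → ℝ, (∀ j, j ∉ S → β j = 0) → gmmObjective W a B b ≤ gmmObjective W a B β

/-- The Wald interval `[b_j - z √(V_jj / N), b_j + z √(V_jj / N)]` for the `j`-th coefficient. -/
def waldInterval {d : ℕ} (z : ℝ) (N : ℕ) (b : Fin d → ℝ) (V : Matrix (Fin d) (Fin d) ℝ)
    (j : Fin d) : Set ℝ :=
  Set.Icc (b j - z * √(V j j / (N : ℝ))) (b j + z * √(V j j / (N : ℝ)))

end

end UnpairedIV

/-! Selection. Let `Q` denote the GMM criterion and `b` the Lasso. The sample moments at the true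
`β` are `O_p(N^{-1/2})`, so `Q(β) = o_p(N^{-1/2})`, which is negligible against the penalty level.
Comparing the penalized criterion at `b` and at `β` gives `‖b‖₁ ≤ ‖β‖₁ + o_p(1)` and `Q(b) =
o_p(1)`. Hence every limit point `y` of `b` satisfies `‖y‖₁ ≤ ‖β‖₁` and `C y = C β` in the
`W₀`-seminorm. The first inequality puts `y - β` in the cone of the restricted eigenvalue condition,
which then forces `y = β` (`RestrictedEigenvalue.eq_of_sum_abs_le`). Plain consistency, without a
rate, suffices: by beta-min, thresholding at `c / 2` then recovers the support with probability
tending to one.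

Refitting. Once the support is right and the Gram matrix on it is invertible, the first order
condition can be solved exactly: the estimation error is `gain` applied to the sample moments at `β`
(`sub_eq_gain_mulVec_of_isRefitGMM`). The random gain converges to a constant matrix `G₀`, so
Slutsky's theorem reduces normality to a central limit theorem for the moments. Exogeneity and
equality of the cross-covariances make the two sample covariances share their mean; independence of
the samples adds their variances, each inflated by the inverse sample fraction. Centring by sample
means costs only a product of two averages of centred variables, which is `o_p(N^{-1/2})`.
Cramér–Wold passes from linear combinations to the vector.

Intervals. The sandwich is `G₀ Ω G₀ᵀ` (`embedBlock_sandwich`), so its plug-in version is consistent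
as soon as the gain and the moment variance are estimated consistently. Studentization then gives
the coverage.

Convergence in probability is treated throughout as convergence along one filter on `ℕ × Ω`, so that
continuity arguments and intersections of events of high probability become ordinary filter
reasoning. -/

namespace UnpairedIV

/-! ### Convergence and boundedness in probability. -/

section ProbFilter

variable {Ω : Type*} [MeasurableSpace Ω] {P : Measure Ω}

/-- The filter of the families of events `A ⊆ ℕ × Ω` whose sections have probability tending
to one. Convergence in probability to a constant is convergence along this filter. -/
def probFilter (P : Measure Ω) : Filter (ℕ × Ω) where
  sets := {A | Tendsto (fun k => P {ω | (k, ω) ∉ A}) atTop (𝓝 0)}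
  univ_sets := by simp
  sets_of_superset {A B} hA hAB :=
    tendsto_of_tendsto_of_tendsto_of_le_of_le tendsto_const_nhds hA (fun _ => zero_le)
      fun _ => measure_mono fun _ hω h => hω (hAB h)
  inter_sets {A B} hA hB := by
    have h : Tendsto (fun k => P {ω | (k, ω) ∉ A} + P {ω | (k, ω) ∉ B}) atTop (𝓝 0) := by
      simpa using Tendsto.add hA hB
    refine tendsto_of_tendsto_of_tendsto_of_le_of_le tendsto_const_nhds h (fun _ => zero_le)
      fun k => (measure_mono fun ω hω => ?_).trans (measure_union_le _ _)
    by_contra hcon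
    simp only [Set.mem_union, Set.mem_ofPred_eq, not_or, not_not] at hcon
    exact hω hcon

lemma eventually_probFilter {p : ℕ × Ω → Prop} :
    (∀ᶠ x in probFilter P, p x) ↔ Tendsto (fun k => P {ω | ¬ p (k, ω)}) atTop (𝓝 0) :=
  Iff.rfl

lemma eventually_probFilter_of_ae {p : ℕ → Ω → Prop} (h : ∀ k, ∀ᵐ ω ∂P, p k ω) :
    ∀ᶠ x in probFilter P, p x.1 x.2 := by
  rw [eventually_probFilter]
  simp_rw [fun k => ae_iff.1 (h k)]
  exact tendsto_const_nhds

/-- Transfers deterministic asymptotics in the index: for `k ≥ K` the exceptional section is empty.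
-/
lemma tendsto_fst_probFilter : Tendsto Prod.fst (probFilter P) atTop := by
  refine tendsto_atTop.2 fun K => ?_
  rw [eventually_probFilter]
  refine tendsto_const_nhds.congr' ?_
  filter_upwards [eventually_ge_atTop K] with k hk
  simp [hk]

/-- The bridge between filter arguments and Mathlib's convergence in measure, which the Slutsky
lemmas use. -/
lemma tendsto_probFilter_iff_tendstoInMeasure {f : ℕ → Ω → ℝ} {a : ℝ} :
    Tendsto (fun x : ℕ × Ω => f x.1 x.2) (probFilter P) (𝓝 a) ↔
      TendstoInMeasure P f atTop fun _ => a := by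
  rw [tendstoInMeasure_iff_norm, Metric.tendsto_nhds]
  simp_rw [eventually_probFilter, Real.dist_eq, Real.norm_eq_abs, not_lt]

lemma tendsto_probFilter_of_ae [IsFiniteMeasure P] {f : ℕ → Ω → ℝ} {a : ℝ}
    (hf : ∀ k, AEStronglyMeasurable (f k) P)
    (h : ∀ᵐ ω ∂P, Tendsto (fun k => f k ω) atTop (𝓝 a)) :
    Tendsto (fun x : ℕ × Ω => f x.1 x.2) (probFilter P) (𝓝 a) :=
  tendsto_probFilter_iff_tendstoInMeasure.2 (tendstoInMeasure_of_tendsto_ae hf h)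

/-- A sequence of real random variables is bounded in probability. -/
def BddInProb (P : Measure Ω) (f : ℕ → Ω → ℝ) : Prop :=
  ∀ ε : ENNReal, 0 < ε → ∃ K : ℝ, 0 < K ∧ ∀ᶠ k in atTop, P {ω | K ≤ |f k ω|} ≤ ε

/-- The rule `O_p(1) · o_p(1) = o_p(1)`: the product can exceed `δ` only if the first factor reaches
`K` or the second reaches `δ / K`. -/
lemma BddInProb.tendsto_mul {f h : ℕ → Ω → ℝ} (hf : BddInProb P f)
    (hh : Tendsto (fun x : ℕ × Ω => h x.1 x.2) (probFilter P) (𝓝 0)) :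
    Tendsto (fun x : ℕ × Ω => f x.1 x.2 * h x.1 x.2) (probFilter P) (𝓝 0) := by
  rw [Metric.tendsto_nhds]
  intro δ hδ
  rw [eventually_probFilter, ENNReal.tendsto_nhds_zero]
  intro ε hε
  obtain ⟨K, hK, hfK⟩ := hf (ε / 2) (ENNReal.half_pos hε.ne')
  have h1 := (Metric.tendsto_nhds.1 hh) (δ / K) (by positivity)
  rw [eventually_probFilter, ENNReal.tendsto_nhds_zero] at h1
  filter_upwards [hfK, h1 (ε / 2) (ENNReal.half_pos hε.ne')] with k h2 h3
  calc P {ω | ¬ dist (f k ω * h k ω) 0 < δ}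
      ≤ P ({ω | K ≤ |f k ω|} ∪ {ω | ¬ dist (h k ω) 0 < δ / K}) := by
        refine measure_mono fun ω hω => ?_
        by_contra hcon
        simp only [Set.mem_union, Set.mem_ofPred_eq, not_or, not_not, not_le, Real.dist_eq,
          sub_zero] at hcon hω
        refine hω ?_
        rw [abs_mul]
        calc |f k ω| * |h k ω| ≤ K * |h k ω| := by gcongr; exact hcon.1.le
          _ < K * (δ / K) := by gcongr; exact hcon.2
          _ = δ := by field_simp
    _ ≤ ε / 2 + ε / 2 := (measure_union_le _ _).trans (add_le_add h2 h3)
    _ = ε := ENNReal.add_halves ε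

/-- A single limit law is tight, and the portmanteau inequality for closed sets carries its tail
bound over to the sequence. -/
lemma bddInProb_of_tendstoInDistribution [IsProbabilityMeasure P] {f : ℕ → Ω → ℝ}
    {ν : Measure ℝ} [IsProbabilityMeasure ν]
    (h : TendstoInDistribution f atTop (id : ℝ → ℝ) (fun _ => P) ν) : BddInProb P f := by
  intro ε hε
  have htight := tendsto_measure_norm_gt_of_isTightMeasureSet (isTightMeasureSet_singleton (μ := ν))
  simp only [Set.mem_singleton_iff, iSup_iSup_eq_left] at htight
  obtain ⟨K, hK, hK0⟩ := ((htight.eventually_lt_const hε).and (eventually_gt_atTop 0)).exists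
  -- Tightness controls the open tail `|x| > K`; passing to `K + 1` gives a closed tail inside it,
  -- as the portmanteau inequality needs.
  refine ⟨K + 1, by positivity, ?_⟩
  have hcl : IsClosed {x : ℝ | K + 1 ≤ |x|} := isClosed_le continuous_const continuous_abs
  have hlim := ProbabilityMeasure.limsup_measure_closed_le_of_tendsto h.tendsto hcl
  have hlt : limsup (fun k => P.map (f k) {x : ℝ | K + 1 ≤ |x|}) atTop < ε := by
    refine lt_of_le_of_lt hlim (lt_of_le_of_lt ?_ hK)
    simp only [ProbabilityMeasure.coe_mk, Measure.map_id]
    refine measure_mono fun x hx => ?_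
    simp only [Set.mem_ofPred_eq, Real.norm_eq_abs] at hx ⊢
    linarith
  filter_upwards [eventually_lt_of_limsup_lt hlt] with k hk
  rw [Measure.map_apply_of_aemeasurable (h.forall_aemeasurable k) hcl.measurableSet] at hk
  exact hk.le

end ProbFilter

/-! ### Consistency of the penalized estimator and support recovery. -/

section Lasso

variable {m d : ℕ}

/-- Mass of `y` off the support must be paid for by a loss of mass on it. The cone constant is 1
here, well within the 3 of the restricted eigenvalue condition. -/
lemma sum_abs_compl_le_of_sum_abs_le {β y : Fin d → ℝ} (h : ∑ j, |y j| ≤ ∑ j, |β j|) :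
    ∑ j ∈ (supp β)ᶜ, |(y - β) j| ≤ ∑ j ∈ supp β, |(y - β) j| := by
  have hz : ∀ j ∈ (supp β)ᶜ, β j = 0 := by simp [supp]
  rw [← Finset.sum_add_sum_compl (supp β), ← Finset.sum_add_sum_compl (supp β) fun j => |β j|,
    Finset.sum_congr (s₁ := (supp β)ᶜ) (f := fun j => |β j|) rfl
      (fun j hj => by rw [hz j hj, abs_zero])] at h
  have h1 : ∑ j ∈ (supp β)ᶜ, |(y - β) j| = ∑ j ∈ (supp β)ᶜ, |y j| :=
    Finset.sum_congr rfl fun j hj => by simp [hz j hj]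
  have h2 : ∑ j ∈ supp β, |β j| - ∑ j ∈ supp β, |y j| ≤ ∑ j ∈ supp β, |(y - β) j| := by
    rw [← Finset.sum_sub_distrib]
    refine Finset.sum_le_sum fun j _ => ?_
    rw [Pi.sub_apply, abs_sub_comm]
    exact abs_sub_abs_le_abs_sub _ _
  simp only [Finset.sum_const_zero, add_zero] at h
  linarith

/-- Under the restricted eigenvalue condition, `β` is the only vector with the image `C β` in the
`W`-seminorm whose `ℓ¹` norm does not exceed that of `β`. -/
lemma RestrictedEigenvalue.eq_of_sum_abs_le {C : Matrix (Fin m) (Fin d) ℝ}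
    {W : Matrix (Fin m) (Fin m) ℝ} {β y : Fin d → ℝ}
    (hRE : RestrictedEigenvalue C W (supp β).card) (h : ∑ j, |y j| ≤ ∑ j, |β j|)
    (hy : (C *ᵥ (y - β)) ⬝ᵥ (W *ᵥ (C *ᵥ (y - β))) ≤ 0) : y = β := by
  obtain ⟨κ, hκ, H⟩ := hRE
  by_contra hne
  have h1 := sum_abs_compl_le_of_sum_abs_le h
  have h2 : 0 ≤ ∑ j ∈ supp β, |(y - β) j| := Finset.sum_nonneg fun _ _ => abs_nonneg _
  have h3 := H (supp β) rfl (y - β) (sub_ne_zero.2 hne) (by linarith)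
  have h4 := div_nonpos_of_nonpos_of_nonneg hy
    (Finset.sum_nonneg fun j (_ : j ∈ Finset.univ) => sq_nonneg ((y - β) j))
  linarith

/-- A compactness argument in place of a rate: `b` eventually stays in a ball, both inequalities
pass to every cluster point, and the restricted eigenvalue condition leaves `β` as the only
candidate. -/
lemma tendsto_of_sum_abs_le_of_gmmObjective {α : Type*} {l : Filter α}
    {C : Matrix (Fin m) (Fin d) ℝ} {W₀ : Matrix (Fin m) (Fin m) ℝ} {β : Fin d → ℝ}
    (hRE : RestrictedEigenvalue C W₀ (supp β).card)
    {W : α → Matrix (Fin m) (Fin m) ℝ} {a : α → Fin m → ℝ} {B : α → Matrix (Fin m) (Fin d) ℝ}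
    {b : α → Fin d → ℝ} {r q : α → ℝ}
    (hW : Tendsto W l (𝓝 W₀)) (ha : Tendsto a l (𝓝 (C *ᵥ β))) (hB : Tendsto B l (𝓝 C))
    (hr : Tendsto r l (𝓝 0)) (hq : Tendsto q l (𝓝 0))
    (hbr : ∀ᶠ x in l, ∑ j, |b x j| ≤ ∑ j, |β j| + r x)
    (hbq : ∀ᶠ x in l, gmmObjective (W x) (a x) (B x) (b x) ≤ q x) :
    Tendsto b l (𝓝 β) := by
  have hcpt : IsCompact (Metric.closedBall (0 : Fin d → ℝ) (∑ j, |β j| + 1)) :=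
    isCompact_closedBall _ _
  refine hcpt.tendsto_nhds_of_unique_mapClusterPt ?_ ?_
  · filter_upwards [hbr, hr.eventually_lt_const one_pos] with x h1 h2
    rw [mem_closedBall_zero_iff, pi_norm_le_iff_of_nonneg (by positivity)]
    intro j
    have h3 : |b x j| ≤ ∑ j, |b x j| :=
      Finset.single_le_sum (f := fun j => |b x j|) (fun j _ => abs_nonneg _) (Finset.mem_univ j)
    rw [Real.norm_eq_abs]
    linarith
  · intro y _ hy
    obtain ⟨u, hul, hu⟩ := mapClusterPt_iff_ultrafilter.1 hy
    refine hRE.eq_of_sum_abs_le ?_ ?_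
    · have h1 : Tendsto (fun x => ∑ j, |b x j|) u (𝓝 (∑ j, |y j|)) :=
        tendsto_finsetSum _ fun j _ => ((tendsto_pi_nhds.1 hu) j).abs
      have h2 : Tendsto (fun x => ∑ j, |β j| + r x) u (𝓝 (∑ j, |β j| + 0)) :=
        (hr.mono_left hul).const_add _
      rw [add_zero] at h2
      exact le_of_tendsto_of_tendsto h1 h2 (hbr.filter_mono hul)
    · have hcont : Continuous fun p : Matrix (Fin m) (Fin m) ℝ × (Fin m → ℝ) ×
          Matrix (Fin m) (Fin d) ℝ × (Fin d → ℝ) => gmmObjective p.1 p.2.1 p.2.2.1 p.2.2.2 := by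
        unfold gmmObjective
        fun_prop
      have h1 : Tendsto (fun x => gmmObjective (W x) (a x) (B x) (b x)) u
          (𝓝 (gmmObjective W₀ (C *ᵥ β) C y)) :=
        hcont.continuousAt.tendsto.comp ((hW.mono_left hul).prodMk_nhds
          ((ha.mono_left hul).prodMk_nhds ((hB.mono_left hul).prodMk_nhds hu)))
      have h2 := le_of_tendsto_of_tendsto h1 (hq.mono_left hul) (hbq.filter_mono hul)
      rw [gmmObjective, ← Matrix.mulVec_sub, ← neg_sub y β, Matrix.mulVec_neg, Matrix.mulVec_neg,
        neg_dotProduct_neg] at h2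
      exact h2

lemma gmmObjective_nonneg {W : Matrix (Fin m) (Fin m) ℝ} (hW : W.PosDef) (a : Fin m → ℝ)
    (B : Matrix (Fin m) (Fin d) ℝ) (b : Fin d → ℝ) : 0 ≤ gmmObjective W a B b := by
  have h := hW.posSemidef.dotProduct_mulVec_nonneg (a - B *ᵥ b)
  rwa [star_trivial] at h

/-- Consistency of the `ℓ¹`-penalized estimator when the penalty level tends to zero more slowly
than the criterion at the true parameter. -/
lemma tendsto_of_isLassoGMM {α : Type*} {l : Filter α}
    {C : Matrix (Fin m) (Fin d) ℝ} {W₀ : Matrix (Fin m) (Fin m) ℝ} {β : Fin d → ℝ}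
    (hRE : RestrictedEigenvalue C W₀ (supp β).card)
    {W : α → Matrix (Fin m) (Fin m) ℝ} {a : α → Fin m → ℝ} {B : α → Matrix (Fin m) (Fin d) ℝ}
    {b : α → Fin d → ℝ} {lam : α → ℝ} (hlam : ∀ x, 0 < lam x)
    (hW : Tendsto W l (𝓝 W₀)) (ha : Tendsto a l (𝓝 (C *ᵥ β))) (hB : Tendsto B l (𝓝 C))
    (hpos : ∀ᶠ x in l, (W x).PosDef)
    (hlam0 : Tendsto lam l (𝓝 0))
    (hQ : Tendsto (fun x => (lam x)⁻¹ * gmmObjective (W x) (a x) (B x) β) l (𝓝 0))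
    (hb : ∀ᶠ x in l, IsLassoGMM (W x) (a x) (B x) (lam x) (b x)) :
    Tendsto b l (𝓝 β) := by
  have hQ0 : Tendsto (fun x => gmmObjective (W x) (a x) (B x) β) l (𝓝 0) := by
    have := hlam0.mul hQ
    rw [mul_zero] at this
    refine this.congr fun x => ?_
    rw [← mul_assoc, mul_inv_cancel₀ (hlam x).ne', one_mul]
  -- Both slacks come from comparing the penalized criterion at `b` and at `β`: dropping the
  -- criterion at `b` and dividing by `lam` gives `r`, dropping the penalty at `b` gives `q`.
  refine tendsto_of_sum_abs_le_of_gmmObjective hRE hW ha hB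
    (r := fun x => 1 / 2 * ((lam x)⁻¹ * gmmObjective (W x) (a x) (B x) β))
    (q := fun x => gmmObjective (W x) (a x) (B x) β + 2 * lam x * ∑ j, |β j|) ?_ ?_ ?_ ?_
  · simpa only [mul_zero] using hQ.const_mul (1 / 2)
  · simpa using hQ0.add ((hlam0.const_mul 2).mul_const (∑ j, |β j|))
  · filter_upwards [hpos, hb] with x h1 h2
    have h3 := gmmObjective_nonneg h1 (a x) (B x) (b x)
    have h4 := h2 β
    have h5 : lam x * ∑ j, |b x j| ≤ lam x * (∑ j, |β j| +
        1 / 2 * ((lam x)⁻¹ * gmmObjective (W x) (a x) (B x) β)) := by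
      have : lam x * (1 / 2 * ((lam x)⁻¹ * gmmObjective (W x) (a x) (B x) β)) =
          1 / 2 * gmmObjective (W x) (a x) (B x) β := by
        field_simp [(hlam x).ne']
      rw [mul_add, this]
      linarith
    exact le_of_mul_le_mul_left h5 (hlam x)
  · filter_upwards [hb] with x h2
    have h4 := h2 β
    have h5 : 0 ≤ lam x * ∑ j, |b x j| :=
      mul_nonneg (hlam x).le (Finset.sum_nonneg fun _ _ => abs_nonneg _)
    linarith

/-- An error below `c / 2` keeps zero coordinates under the threshold and coordinates of size at
least `c` above it. -/
lemma eventually_selected_eq {α : Type*} {l : Filter α} {β : Fin d → ℝ} {c : ℝ} (hc : 0 < c)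
    (hmin : ∀ j ∈ supp β, c ≤ |β j|) {b : α → Fin d → ℝ} (hb : Tendsto b l (𝓝 β)) :
    ∀ᶠ x in l, selected c (b x) = supp β := by
  filter_upwards [Metric.tendsto_nhds.1 hb (c / 2) (by positivity)] with x hx
  ext j
  have hj : |b x j - β j| < c / 2 := (dist_pi_lt_iff (by positivity)).1 hx j
  have h1 := abs_lt.1 (lt_of_le_of_lt (abs_abs_sub_abs_le_abs_sub (b x j) (β j)) hj)
  simp only [selected, Finset.mem_filter, Finset.mem_univ, true_and]
  constructor
  · intro h
    by_contra hj0
    have : β j = 0 := by simpa [supp] using hj0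
    rw [this, abs_zero] at h1
    linarith
  · intro h
    have := hmin j h
    linarith [h1.1]

end Lasso

/-! ### Linear algebra of the refitted estimator. -/

section Refit

variable {m d : ℕ}

/-- The inclusion of the coordinates in `S`, as a matrix. -/
def inclMatrix (S : Finset (Fin d)) : Matrix (Fin d) S ℝ :=
  (1 : Matrix (Fin d) (Fin d) ℝ).submatrix id Subtype.val

lemma cols_eq_mul (C : Matrix (Fin m) (Fin d) ℝ) (S : Finset (Fin d)) :
    cols C S = C * inclMatrix S := by
  ext i j
  simp [cols, inclMatrix, Matrix.mul_apply, Matrix.one_apply]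

lemma inclMatrix_mulVec (S : Finset (Fin d)) (v : S → ℝ) (i : Fin d) :
    (inclMatrix S *ᵥ v) i = if h : i ∈ S then v ⟨i, h⟩ else 0 := by
  simp only [inclMatrix, Matrix.mulVec, dotProduct, Matrix.submatrix_apply, id_eq,
    Matrix.one_apply, ite_mul, one_mul, zero_mul]
  split_ifs with h
  · rw [Finset.sum_eq_single ⟨i, h⟩] <;> simp
    intro a ha hne he
    exact absurd he.symm hne
  · exact Finset.sum_eq_zero fun x _ => if_neg fun he : i = x => h (he ▸ x.2)

lemma embedBlock_eq_mul (S : Finset (Fin d)) (V : Matrix S S ℝ) :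
    embedBlock S V = inclMatrix S * V * (inclMatrix S)ᵀ := by
  have h1 : ∀ {p : Type} [Fintype p] (M : Matrix S p ℝ) i j,
      (inclMatrix S * M) i j = if h : i ∈ S then M ⟨i, h⟩ j else 0 := fun M i j =>
    inclMatrix_mulVec S (fun k => M k j) i
  ext i j
  have h2 : (inclMatrix S * V * (inclMatrix S)ᵀ) i j =
      (inclMatrix S * (inclMatrix S * V)ᵀ) j i := by
    rw [← Matrix.transpose_apply (inclMatrix S * V * (inclMatrix S)ᵀ), Matrix.transpose_mul,
      Matrix.transpose_transpose]
  rw [h2, h1, embedBlock, Matrix.of_apply]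
  by_cases hj : j ∈ S
  · by_cases hi : i ∈ S <;> simp [hi, hj, h1]
  · simp [hj]

lemma inclMatrix_mulVec_restrict {S : Finset (Fin d)} {b : Fin d → ℝ} (hb : ∀ j, j ∉ S → b j = 0) :
    inclMatrix S *ᵥ (fun j => b j) = b := by
  ext i
  rw [inclMatrix_mulVec]
  split_ifs with h
  · rfl
  · exact (hb i h).symm

/-- The linear map that takes the sample moments at the true parameter to the estimation error of
the estimator refitted on `S`. -/
noncomputable def gain (B : Matrix (Fin m) (Fin d) ℝ) (W : Matrix (Fin m) (Fin m) ℝ)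
    (S : Finset (Fin d)) : Matrix (Fin d) (Fin m) ℝ :=
  inclMatrix S * (((cols B S)ᵀ * W * cols B S)⁻¹ * ((cols B S)ᵀ * W))

/-- Written through `gain`, the embedded sandwich is visibly the covariance of a linear image of the
moments, and lives in a space that does not depend on `S`. -/
lemma embedBlock_sandwich (C : Matrix (Fin m) (Fin d) ℝ) {W : Matrix (Fin m) (Fin m) ℝ}
    (hW : Wᵀ = W) (O : Matrix (Fin m) (Fin m) ℝ) (S : Finset (Fin d)) :
    embedBlock S (sandwich C W O S) = gain C W S * O * (gain C W S)ᵀ := by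
  rw [embedBlock_eq_mul, sandwich, gain]
  simp only [Matrix.transpose_mul, Matrix.transpose_nonsing_inv, Matrix.transpose_transpose, hW,
    Matrix.mul_assoc]

/-- The first order condition without calculus: moving by `t • h` changes the criterion by a
quadratic in `t` with no constant term. It is nonnegative for all `t`, so its discriminant, the
square of the linear coefficient, is at most 0. -/
lemma dotProduct_mulVec_eq_zero_of_isRefitGMM {W : Matrix (Fin m) (Fin m) ℝ} (hW : Wᵀ = W)
    {a : Fin m → ℝ} {B : Matrix (Fin m) (Fin d) ℝ} {S : Finset (Fin d)} {b : Fin d → ℝ}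
    (hb : IsRefitGMM W a B S b) {h : Fin d → ℝ} (hh : ∀ j, j ∉ S → h j = 0) :
    (B *ᵥ h) ⬝ᵥ (W *ᵥ (a - B *ᵥ b)) = 0 := by
  have key : ∀ t : ℝ, 0 ≤ ((B *ᵥ h) ⬝ᵥ (W *ᵥ (B *ᵥ h))) * (t * t) +
      (-2 * ((B *ᵥ h) ⬝ᵥ (W *ᵥ (a - B *ᵥ b)))) * t + 0 := by
    intro t
    have h1 := hb.2 (b + t • h) fun j hj => by simp [hb.1 j hj, hh j hj]
    have hsymm : (a - B *ᵥ b) ⬝ᵥ (W *ᵥ (B *ᵥ h)) = (B *ᵥ h) ⬝ᵥ (W *ᵥ (a - B *ᵥ b)) := by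
      rw [Matrix.dotProduct_mulVec, ← Matrix.mulVec_transpose, hW, dotProduct_comm]
    have h2 : a - B *ᵥ (b + t • h) = (a - B *ᵥ b) - t • (B *ᵥ h) := by
      rw [Matrix.mulVec_add, Matrix.mulVec_smul]
      abel
    rw [gmmObjective, gmmObjective, h2] at h1
    generalize a - B *ᵥ b = e at h1 hsymm ⊢
    rw [Matrix.mulVec_sub, Matrix.mulVec_smul, sub_dotProduct, dotProduct_sub, dotProduct_sub,
      smul_dotProduct, smul_dotProduct, dotProduct_smul, dotProduct_smul, hsymm] at h1
    simp only [smul_eq_mul] at h1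
    linarith
  have hd := discrim_le_zero key
  simp only [discrim, mul_zero, sub_zero] at hd
  nlinarith [sq_nonneg ((B *ᵥ h) ⬝ᵥ (W *ᵥ (a - B *ᵥ b)))]

/-- The criterion is quadratic, so the normal equations give an exact identity with no Taylor
remainder. Invertibility of the Gram matrix is all that is needed to solve them. -/
lemma sub_eq_gain_mulVec_of_isRefitGMM {W : Matrix (Fin m) (Fin m) ℝ} (hW : Wᵀ = W)
    {a : Fin m → ℝ} {B : Matrix (Fin m) (Fin d) ℝ} {S : Finset (Fin d)} {b β : Fin d → ℝ}
    (hb : IsRefitGMM W a B S b) (hβ : ∀ j, j ∉ S → β j = 0)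
    (hdet : ((cols B S)ᵀ * W * cols B S).det ≠ 0) :
    b - β = gain B W S *ᵥ (a - B *ᵥ β) := by
  have hsub : ∀ j, j ∉ S → (b - β) j = 0 := fun j hj => by simp [hb.1 j hj, hβ j hj]
  have hfoc : ((cols B S)ᵀ * W) *ᵥ (a - B *ᵥ b) = 0 := by
    ext j
    have h1 := dotProduct_mulVec_eq_zero_of_isRefitGMM hW hb (h := inclMatrix S *ᵥ Pi.single j 1)
      fun i hi => by rw [inclMatrix_mulVec, dif_neg hi]
    rw [Matrix.mulVec_mulVec, ← cols_eq_mul] at h1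
    rw [Matrix.mulVec_single_one] at h1
    rw [← Matrix.mulVec_mulVec]
    exact h1
  have hv := inclMatrix_mulVec_restrict hsub
  set v : S → ℝ := fun j => (b - β) j with hvdef
  have h2 : a - B *ᵥ β = (a - B *ᵥ b) + cols B S *ᵥ v := by
    rw [cols_eq_mul, ← Matrix.mulVec_mulVec, hv, Matrix.mulVec_sub]
    abel
  rw [gain, h2, ← Matrix.mulVec_mulVec, ← Matrix.mulVec_mulVec, Matrix.mulVec_add, hfoc, zero_add,
    Matrix.mulVec_mulVec v, Matrix.mulVec_mulVec v,
    Matrix.nonsing_inv_mul _ (isUnit_iff_ne_zero.2 hdet), Matrix.one_mulVec, hv]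

end Refit

/-! ### Continuity of the gain matrix, and invertibility of the Gram matrix. -/

section Continuity

variable {m d : ℕ}

lemma tendsto_nonsing_inv {α ι : Type*} [Fintype ι] [DecidableEq ι] {l : Filter α}
    {A : α → Matrix ι ι ℝ} {A₀ : Matrix ι ι ℝ} (hA : Tendsto A l (𝓝 A₀)) (h0 : A₀.det ≠ 0) :
    Tendsto (fun x => (A x)⁻¹) l (𝓝 A₀⁻¹) := by
  simp only [Matrix.inv_def, Ring.inverse_eq_inv']
  exact (((continuous_id.matrix_det.tendsto A₀).comp hA).inv₀ h0).smul
    ((continuous_id.matrix_adjugate.tendsto A₀).comp hA)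

lemma tendsto_matrix_mul {α p q r : Type*} [Fintype q] {l : Filter α}
    {A : α → Matrix p q ℝ} {B : α → Matrix q r ℝ} {A₀ : Matrix p q ℝ} {B₀ : Matrix q r ℝ}
    (hA : Tendsto A l (𝓝 A₀)) (hB : Tendsto B l (𝓝 B₀)) :
    Tendsto (fun x => A x * B x) l (𝓝 (A₀ * B₀)) :=
  tendsto_pi_nhds.2 fun i => tendsto_pi_nhds.2 fun j => tendsto_finsetSum _ fun k _ =>
    (tendsto_pi_nhds.1 (tendsto_pi_nhds.1 hA i) k).mul
      (tendsto_pi_nhds.1 (tendsto_pi_nhds.1 hB k) j)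

lemma tendsto_mulVec {α p q : Type*} [Fintype q] {l : Filter α}
    {A : α → Matrix p q ℝ} {v : α → q → ℝ} {A₀ : Matrix p q ℝ} {v₀ : q → ℝ}
    (hA : Tendsto A l (𝓝 A₀)) (hv : Tendsto v l (𝓝 v₀)) :
    Tendsto (fun x => A x *ᵥ v x) l (𝓝 (A₀ *ᵥ v₀)) := by
  refine tendsto_pi_nhds.2 fun i => ?_
  simp only [Matrix.mulVec, dotProduct]
  exact tendsto_finsetSum _ fun k _ =>
    (tendsto_pi_nhds.1 (tendsto_pi_nhds.1 hA i) k).mul (tendsto_pi_nhds.1 hv k)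

lemma tendsto_cols {α : Type*} {l : Filter α} {B : α → Matrix (Fin m) (Fin d) ℝ}
    {C : Matrix (Fin m) (Fin d) ℝ} (hB : Tendsto B l (𝓝 C)) (S : Finset (Fin d)) :
    Tendsto (fun x => cols (B x) S) l (𝓝 (cols C S)) :=
  tendsto_pi_nhds.2 fun i => tendsto_pi_nhds.2 fun j =>
    tendsto_pi_nhds.1 (tendsto_pi_nhds.1 hB i) j

lemma tendsto_transpose {α p q : Type*} {l : Filter α} {A : α → Matrix p q ℝ}
    {A₀ : Matrix p q ℝ} (hA : Tendsto A l (𝓝 A₀)) : Tendsto (fun x => (A x)ᵀ) l (𝓝 A₀ᵀ) :=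
  tendsto_pi_nhds.2 fun i => tendsto_pi_nhds.2 fun j =>
    tendsto_pi_nhds.1 (tendsto_pi_nhds.1 hA j) i

lemma tendsto_gram {α : Type*} {l : Filter α} {B : α → Matrix (Fin m) (Fin d) ℝ}
    {W : α → Matrix (Fin m) (Fin m) ℝ} {C : Matrix (Fin m) (Fin d) ℝ}
    {W₀ : Matrix (Fin m) (Fin m) ℝ} (hB : Tendsto B l (𝓝 C)) (hW : Tendsto W l (𝓝 W₀))
    (S : Finset (Fin d)) :
    Tendsto (fun x => (cols (B x) S)ᵀ * W x * cols (B x) S) l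
      (𝓝 ((cols C S)ᵀ * W₀ * cols C S)) := by
  exact tendsto_matrix_mul
    (tendsto_matrix_mul (tendsto_transpose (tendsto_cols hB S)) hW) (tendsto_cols hB S)

lemma tendsto_gain {α : Type*} {l : Filter α} {B : α → Matrix (Fin m) (Fin d) ℝ}
    {W : α → Matrix (Fin m) (Fin m) ℝ} {C : Matrix (Fin m) (Fin d) ℝ}
    {W₀ : Matrix (Fin m) (Fin m) ℝ} (hB : Tendsto B l (𝓝 C)) (hW : Tendsto W l (𝓝 W₀))
    {S : Finset (Fin d)} (h0 : ((cols C S)ᵀ * W₀ * cols C S).det ≠ 0) :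
    Tendsto (fun x => gain (B x) (W x) S) l (𝓝 (gain C W₀ S)) := by
  exact tendsto_matrix_mul tendsto_const_nhds (tendsto_matrix_mul
    (tendsto_nonsing_inv (tendsto_gram hB hW S) h0)
    (tendsto_matrix_mul (tendsto_transpose (tendsto_cols hB S)) hW))

/-- The restricted eigenvalue condition makes the columns of `C` on the support independent. -/
lemma RestrictedEigenvalue.det_gram_ne_zero {C : Matrix (Fin m) (Fin d) ℝ}
    {W W' : Matrix (Fin m) (Fin m) ℝ} {S : Finset (Fin d)}
    (hRE : RestrictedEigenvalue C W S.card) (hW' : W'.PosDef) :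
    ((cols C S)ᵀ * W' * cols C S).det ≠ 0 := by
  have hinj : Function.Injective (cols C S).mulVec := by
    rw [← Matrix.coe_mulVecLin, ← LinearMap.ker_eq_bot, LinearMap.ker_eq_bot']
    intro v hv
    rw [Matrix.mulVecLin_apply, cols_eq_mul, ← Matrix.mulVec_mulVec] at hv
    obtain ⟨κ, hκ, H⟩ := hRE
    by_contra hne
    have hne' : inclMatrix S *ᵥ v ≠ 0 := by
      intro h0
      refine hne (funext fun j => ?_)
      have := congrFun h0 j
      rwa [inclMatrix_mulVec, dif_pos j.2] at this
    -- A vector supported on `S` has no mass off `S`, so it lies in the cone trivially.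
    have h1 := H S rfl _ hne' (by
      rw [Finset.sum_eq_zero fun j hj => by
        rw [inclMatrix_mulVec, dif_neg (Finset.mem_compl.1 hj), abs_zero]]
      exact mul_nonneg (by norm_num) (Finset.sum_nonneg fun _ _ => abs_nonneg _))
    rw [hv, zero_dotProduct, zero_div] at h1
    linarith
  have := hW'.conjTranspose_mul_mul_same hinj
  rw [Matrix.conjTranspose_eq_transpose_of_trivial] at this
  exact this.det_pos.ne'

end Continuity

/-! ### Algebra of sample means and sample covariances. -/

section Averages

lemma avg_apply {ι : Type*} (n : ℕ) (v : ℕ → ι → ℝ) (a : ι) :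
    avg n v a = avg n fun i => v i a := by
  simp [avg]

lemma Centering.shift_apply {ι : Type*} (c : Centering) (n : ℕ) (v : ℕ → ι → ℝ) (a : ι) :
    c.shift n v a = c.shift n fun i => v i a := by
  cases c
  · rfl
  · exact avg_apply n v a

lemma avg_sum {ι : Type*} (s : Finset ι) (n : ℕ) (v : ι → ℕ → ℝ) :
    avg n (fun i => ∑ j ∈ s, v j i) = ∑ j ∈ s, avg n (v j) := by
  simp only [avg, smul_eq_mul, Finset.mul_sum]
  exact Finset.sum_comm

lemma avg_mul_const (n : ℕ) (v : ℕ → ℝ) (r : ℝ) : avg n (fun i => v i * r) = avg n v * r := by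
  simp only [avg, smul_eq_mul, ← Finset.sum_mul, mul_assoc]

lemma avg_const_mul (n : ℕ) (v : ℕ → ℝ) (r : ℝ) : avg n (fun i => r * v i) = r * avg n v := by
  simp only [mul_comm r, avg_mul_const]

lemma avg_sub (n : ℕ) (v w : ℕ → ℝ) : avg n (fun i => v i - w i) = avg n v - avg n w := by
  simp only [avg, smul_eq_mul, Finset.sum_sub_distrib, mul_sub]

lemma avg_const {n : ℕ} (hn : n ≠ 0) (r : ℝ) : avg n (fun _ => r) = r := by
  simp [avg, hn]

lemma avg_zero (v : ℕ → ℝ) : avg 0 v = 0 := by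
  simp [avg]

lemma avg_sub_avg_mul (n : ℕ) (v w : ℕ → ℝ) :
    avg n (fun i => (v i - avg n v) * (w i - avg n w)) =
      avg n (fun i => v i * w i) - avg n v * avg n w := by
  -- The empty average of a constant is 0 rather than the constant, so `n = 0` is separate.
  rcases eq_or_ne n 0 with rfl | hn
  · simp [avg_zero]
  have h : ∀ i, (v i - avg n v) * (w i - avg n w) =
      (v i * w i - v i * avg n w) - (avg n v * w i - avg n v * avg n w) := fun i => by ring
  simp_rw [h]
  rw [avg_sub, avg_sub, avg_sub, avg_mul_const, avg_const_mul, avg_const hn]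
  ring

lemma sampleProduct_apply {p : ℕ} (c : Centering) (n : ℕ) (A : ℕ → Fin p → ℝ) (b : ℕ → ℝ) (i : ℕ)
    (a : Fin p) : sampleProduct c n A b i a =
      (b i - c.shift n b) * (A i a - c.shift n fun i => A i a) := by
  simp [sampleProduct, Centering.shift_apply]

lemma sampleVar_apply {p : ℕ} (n : ℕ) (z : ℕ → Fin p → ℝ) (a a' : Fin p) :
    sampleVar n z a a' = avg n (fun i => z i a * z i a') -
      avg n (fun i => z i a) * avg n (fun i => z i a') := by
  rw [← avg_sub_avg_mul]
  simp [sampleVar, avg, Matrix.sum_apply, Matrix.vecMulVec_apply]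

lemma Centering.shift_dotProduct {q : ℕ} (c : Centering) (n : ℕ) (B : ℕ → Fin q → ℝ)
    (b : Fin q → ℝ) :
    (c.shift n fun i => B i ⬝ᵥ b) = ∑ u, (c.shift n fun i => B i u) * b u := by
  cases c
  · simp [Centering.shift]
  · simp only [Centering.shift, dotProduct]
    rw [avg_sum]
    simp_rw [avg_mul_const]

lemma sampleProduct_dotProduct {p q : ℕ} (c : Centering) (n : ℕ) (A : ℕ → Fin p → ℝ)
    (B : ℕ → Fin q → ℝ) (b : Fin q → ℝ) (i : ℕ) (a : Fin p) :
    sampleProduct c n A (fun j => B j ⬝ᵥ b) i a =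
      ∑ u, sampleProduct c n A (fun j => B j u) i a * b u := by
  simp only [sampleProduct_apply, Centering.shift_dotProduct]
  rw [dotProduct, ← Finset.sum_sub_distrib, Finset.sum_mul]
  exact Finset.sum_congr rfl fun u _ => by ring

lemma sampleCovMat_mulVec {p q : ℕ} (c : Centering) (n : ℕ) (A : ℕ → Fin p → ℝ)
    (B : ℕ → Fin q → ℝ) (b : Fin q → ℝ) :
    sampleCovMat c n A B *ᵥ b = sampleCovVec c n A fun j => B j ⬝ᵥ b := by
  ext a
  simp only [sampleCovMat, sampleCovVec, Matrix.mulVec, dotProduct, Matrix.of_apply, avg_apply]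
  have h := fun i => sampleProduct_dotProduct c n A B b i a
  simp only [dotProduct] at h
  simp_rw [h]
  rw [avg_sum]
  simp_rw [avg_mul_const]

/-- Separates `b` from the data: the coefficients of this quadratic form in `b` are free of `b`. A
random `b`, depending on the same data, can therefore be inserted without a uniform law of large
numbers. -/
lemma sampleVar_dotProduct {p q : ℕ} (c : Centering) (n : ℕ) (A : ℕ → Fin p → ℝ)
    (B : ℕ → Fin q → ℝ) (b : Fin q → ℝ) (a a' : Fin p) :
    sampleVar n (sampleProduct c n A fun j => B j ⬝ᵥ b) a a' =
      ∑ u, ∑ v, b u * b v *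
        (avg n (fun i => sampleProduct c n A (fun j => B j u) i a *
            sampleProduct c n A (fun j => B j v) i a') -
          avg n (fun i => sampleProduct c n A (fun j => B j u) i a) *
            avg n (fun i => sampleProduct c n A (fun j => B j v) i a')) := by
  rw [sampleVar_apply]
  simp_rw [sampleProduct_dotProduct, Finset.sum_mul_sum]
  rw [avg_sum, avg_sum, avg_sum, Finset.sum_mul_sum, ← Finset.sum_sub_distrib]
  refine Finset.sum_congr rfl fun u _ => ?_
  rw [avg_sum, ← Finset.sum_sub_distrib]
  refine Finset.sum_congr rfl fun v _ => ?_
  rw [avg_mul_const, avg_mul_const]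
  have h : ∀ i, sampleProduct c n A (fun j => B j u) i a * b u *
      (sampleProduct c n A (fun j => B j v) i a' * b v) =
      sampleProduct c n A (fun j => B j u) i a * sampleProduct c n A (fun j => B j v) i a' *
        (b u * b v) := fun i => by ring
  simp_rw [h]
  rw [avg_mul_const]
  ring

end Averages

/-! ### Laws of large numbers for centred products. -/

section LawOfLargeNumbers

variable {Ω E : Type*} [MeasurableSpace Ω] [MeasurableSpace E] {P : Measure Ω}
  [IsProbabilityMeasure P] {Z : ℕ → Ω → E} {Z₀ : Ω → E} {n : ℕ → ℕ}

lemma tendsto_avg_probFilter (hid : ∀ i, IdentDistrib (Z i) Z₀ P P) (hind : iIndepFun Z P)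
    (hn : Tendsto n atTop atTop) {f : E → ℝ} (hf : Measurable f)
    (hint : Integrable (fun ω => f (Z₀ ω)) P) :
    Tendsto (fun x : ℕ × Ω => avg (n x.1) fun i => f (Z i x.2)) (probFilter P)
      (𝓝 (∫ ω, f (Z₀ ω) ∂P)) := by
  have hid' : ∀ i, IdentDistrib (fun ω => f (Z i ω)) (fun ω => f (Z₀ ω)) P P :=
    fun i => (hid i).comp hf
  refine tendsto_probFilter_of_ae (f := fun k ω => avg (n k) fun i => f (Z i ω)) (fun k => ?_) ?_
  · refine AEMeasurable.aestronglyMeasurable ?_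
    simp only [avg, smul_eq_mul]
    exact (Finset.aemeasurable_fun_sum _ fun i _ => (hid' i).aemeasurable_fst).const_mul _
  · have h := strong_law_ae_real (fun i ω => f (Z i ω)) ((hid' 0).integrable_iff.2 hint)
      (fun i j hij => (hind.indepFun hij).comp hf hf)
      fun i => (hid' i).trans (hid' 0).symm
    rw [(hid' 0).integral_eq] at h
    filter_upwards [h] with ω hω
    refine (hω.comp hn).congr fun k => ?_
    simp [avg, div_eq_inv_mul]

/-- The shifts `s` depend on the whole sample, so the summands are not independent. Expanding the
product over subsets pulls the shifts out of the average and leaves finitely many averages of i.i.d.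
monomials. -/
lemma tendsto_avg_prod_sub_probFilter {ι : Type*} [Fintype ι] [DecidableEq ι]
    (hid : ∀ i, IdentDistrib (Z i) Z₀ P P) (hind : iIndepFun Z P)
    (hn : Tendsto n atTop atTop) {f : ι → E → ℝ} (hf : ∀ l, Measurable (f l))
    (hint : ∀ T : Finset ι, Integrable (fun ω => ∏ l ∈ T, f l (Z₀ ω)) P)
    {s : ι → ℕ × Ω → ℝ} {σ : ι → ℝ} (hs : ∀ l, Tendsto (s l) (probFilter P) (𝓝 (σ l))) :
    Tendsto (fun x : ℕ × Ω => avg (n x.1) fun i => ∏ l, (f l (Z i x.2) - s l x)) (probFilter P)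
      (𝓝 (∫ ω, ∏ l, (f l (Z₀ ω) - σ l) ∂P)) := by
  simp_rw [Finset.prod_sub, avg_sum, avg_mul_const, avg_const_mul]
  rw [integral_finsetSum _ fun T _ => ((hint _).const_mul _).mul_const _]
  simp_rw [integral_mul_const, integral_const_mul]
  refine tendsto_finsetSum _ fun T _ => ((Tendsto.const_mul _ ?_).mul
    (tendsto_finsetProd _ fun l _ => hs l))
  exact tendsto_avg_probFilter hid hind hn (f := fun z => ∏ l ∈ Finset.univ \ T, f l z)
    (Finset.measurable_prod _ fun l _ => hf l) (hint _)

lemma tendsto_shift_probFilter (hid : ∀ i, IdentDistrib (Z i) Z₀ P P) (hind : iIndepFun Z P)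
    (hn : Tendsto n atTop atTop) {f : E → ℝ} (hf : Measurable f)
    (hint : Integrable (fun ω => f (Z₀ ω)) P) {c : Centering}
    (hc : c = Centering.population → ∫ ω, f (Z₀ ω) ∂P = 0) :
    Tendsto (fun x : ℕ × Ω => c.shift (n x.1) fun i => f (Z i x.2)) (probFilter P)
      (𝓝 (∫ ω, f (Z₀ ω) ∂P)) := by
  cases c
  · simp only [Centering.shift, hc rfl]
    exact tendsto_const_nhds
  · exact tendsto_avg_probFilter hid hind hn hf hint

/-- Hölder's inequality: the reciprocal exponents add up to `T.card / 4 ≤ 1`. -/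
lemma integrable_prod_of_memLp_four {ι : Type*} [Fintype ι] (hι : Fintype.card ι ≤ 4)
    {F : ι → Ω → ℝ} (hF : ∀ l, MemLp (F l) 4 P) (T : Finset ι) :
    Integrable (fun ω => ∏ l ∈ T, F l ω) P := by
  have h := MemLp.prod' (s := T) (p := fun _ => 4) fun l _ => hF l
  refine h.integrable ?_
  rw [Finset.sum_const, nsmul_eq_mul, ENNReal.one_le_inv]
  have h1 : (T.card : ENNReal) ≤ 4 := by
    exact_mod_cast (Finset.card_le_univ T).trans hι
  calc (T.card : ENNReal) * 4⁻¹ ≤ 4 * 4⁻¹ := by gcongr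
    _ = 1 := ENNReal.mul_inv_cancel (by norm_num) (by norm_num)

lemma tendsto_avg_sampleProduct (hid : ∀ i, IdentDistrib (Z i) Z₀ P P) (hind : iIndepFun Z P)
    (hn : Tendsto n atTop atTop) {p : ℕ} {A : E → Fin p → ℝ} {b : E → ℝ}
    (hA : ∀ a, Measurable fun z => A z a) (hb : Measurable b)
    (hA4 : ∀ a, MemLp (fun ω => A (Z₀ ω) a) 4 P) (hb4 : MemLp (fun ω => b (Z₀ ω)) 4 P)
    {c : Centering} (hcA : c = Centering.population → ∀ a, ∫ ω, A (Z₀ ω) a ∂P = 0)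
    (hcb : c = Centering.population → ∫ ω, b (Z₀ ω) ∂P = 0) (a : Fin p) :
    Tendsto (fun x : ℕ × Ω => avg (n x.1) fun i => sampleProduct c (n x.1)
        (fun i => A (Z i x.2)) (fun i => b (Z i x.2)) i a) (probFilter P)
      (𝓝 (∫ ω, centeredProduct P (fun ω => A (Z₀ ω)) (fun ω => b (Z₀ ω)) ω a ∂P)) := by
  have hm : ∀ l, Measurable ((![b, fun z => A z a] : Fin 2 → E → ℝ) l) := by
    intro l; fin_cases l
    exacts [hb, hA a]
  have h4 : ∀ l, MemLp (fun ω => (![b, fun z => A z a] : Fin 2 → E → ℝ) l (Z₀ ω)) 4 P := by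
    intro l; fin_cases l
    exacts [hb4, hA4 a]
  have hc : ∀ l, c = Centering.population →
      ∫ ω, (![b, fun z => A z a] : Fin 2 → E → ℝ) l (Z₀ ω) ∂P = 0 := by
    intro l h; fin_cases l
    exacts [hcb h, hcA h a]
  have h := tendsto_avg_prod_sub_probFilter hid hind hn hm
    (integrable_prod_of_memLp_four (by simp) h4)
    (fun l => tendsto_shift_probFilter hid hind hn (hm l)
      ((h4 l).integrable (by norm_num)) (hc l))
  simpa [Fin.prod_univ_two, sampleProduct_apply, centeredProduct] using h

lemma tendsto_avg_sampleProduct_mul (hid : ∀ i, IdentDistrib (Z i) Z₀ P P) (hind : iIndepFun Z P)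
    (hn : Tendsto n atTop atTop) {p : ℕ} {A : E → Fin p → ℝ} {b b' : E → ℝ}
    (hA : ∀ a, Measurable fun z => A z a) (hb : Measurable b) (hb' : Measurable b')
    (hA4 : ∀ a, MemLp (fun ω => A (Z₀ ω) a) 4 P) (hb4 : MemLp (fun ω => b (Z₀ ω)) 4 P)
    (hb4' : MemLp (fun ω => b' (Z₀ ω)) 4 P)
    {c : Centering} (hcA : c = Centering.population → ∀ a, ∫ ω, A (Z₀ ω) a ∂P = 0)
    (hcb : c = Centering.population → ∫ ω, b (Z₀ ω) ∂P = 0)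
    (hcb' : c = Centering.population → ∫ ω, b' (Z₀ ω) ∂P = 0) (a a' : Fin p) :
    Tendsto (fun x : ℕ × Ω => avg (n x.1) fun i =>
        sampleProduct c (n x.1) (fun i => A (Z i x.2)) (fun i => b (Z i x.2)) i a *
        sampleProduct c (n x.1) (fun i => A (Z i x.2)) (fun i => b' (Z i x.2)) i a') (probFilter P)
      (𝓝 (∫ ω, centeredProduct P (fun ω => A (Z₀ ω)) (fun ω => b (Z₀ ω)) ω a *
        centeredProduct P (fun ω => A (Z₀ ω)) (fun ω => b' (Z₀ ω)) ω a' ∂P)) := by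
  -- A product of two summands has four factors, which is exactly what fourth moments make
  -- integrable.
  have hm : ∀ l, Measurable
      ((![b, fun z => A z a, b', fun z => A z a'] : Fin 4 → E → ℝ) l) := by
    intro l; fin_cases l
    exacts [hb, hA a, hb', hA a']
  have h4 : ∀ l, MemLp
      (fun ω => (![b, fun z => A z a, b', fun z => A z a'] : Fin 4 → E → ℝ) l (Z₀ ω)) 4 P := by
    intro l; fin_cases l
    exacts [hb4, hA4 a, hb4', hA4 a']
  have hc : ∀ l, c = Centering.population →
      ∫ ω, (![b, fun z => A z a, b', fun z => A z a'] : Fin 4 → E → ℝ) l (Z₀ ω) ∂P = 0 := by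
    intro l h; fin_cases l
    exacts [hcb h, hcA h a, hcb' h, hcA h a']
  have h := tendsto_avg_prod_sub_probFilter hid hind hn hm
    (integrable_prod_of_memLp_four (by simp) h4)
    (fun l => tendsto_shift_probFilter hid hind hn (hm l)
      ((h4 l).integrable (by norm_num)) (hc l))
  simpa [Fin.prod_univ_four, sampleProduct_apply, centeredProduct, mul_assoc] using h

lemma memLp_two_centeredProduct {p : ℕ} {A : Ω → Fin p → ℝ} {b : Ω → ℝ}
    (hA4 : ∀ a, MemLp (fun ω => A ω a) 4 P) (hb4 : MemLp b 4 P) (a : Fin p) :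
    MemLp (fun ω => centeredProduct P A b ω a) 2 P := by
  have : ENNReal.HolderTriple 4 4 2 := ⟨by
    rw [← two_mul, show (4 : ENNReal) = 2 * 2 by norm_num,
      ENNReal.mul_inv (by norm_num) (by norm_num), ← mul_assoc,
      ENNReal.mul_inv_cancel (by norm_num) (by norm_num), one_mul]⟩
  exact ((hA4 a).sub (memLp_const _)).mul (hb4.sub (memLp_const _))

lemma tendsto_sample_covariance (hid : ∀ i, IdentDistrib (Z i) Z₀ P P) (hind : iIndepFun Z P)
    (hn : Tendsto n atTop atTop) {p : ℕ} {A : E → Fin p → ℝ} {b b' : E → ℝ}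
    (hA : ∀ a, Measurable fun z => A z a) (hb : Measurable b) (hb' : Measurable b')
    (hA4 : ∀ a, MemLp (fun ω => A (Z₀ ω) a) 4 P) (hb4 : MemLp (fun ω => b (Z₀ ω)) 4 P)
    (hb4' : MemLp (fun ω => b' (Z₀ ω)) 4 P)
    {c : Centering} (hcA : c = Centering.population → ∀ a, ∫ ω, A (Z₀ ω) a ∂P = 0)
    (hcb : c = Centering.population → ∫ ω, b (Z₀ ω) ∂P = 0)
    (hcb' : c = Centering.population → ∫ ω, b' (Z₀ ω) ∂P = 0) (a a' : Fin p) :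
    Tendsto (fun x : ℕ × Ω =>
        avg (n x.1) (fun i =>
          sampleProduct c (n x.1) (fun i => A (Z i x.2)) (fun i => b (Z i x.2)) i a *
          sampleProduct c (n x.1) (fun i => A (Z i x.2)) (fun i => b' (Z i x.2)) i a') -
        avg (n x.1) (fun i =>
          sampleProduct c (n x.1) (fun i => A (Z i x.2)) (fun i => b (Z i x.2)) i a) *
        avg (n x.1) (fun i =>
          sampleProduct c (n x.1) (fun i => A (Z i x.2)) (fun i => b' (Z i x.2)) i a'))
      (probFilter P)
      (𝓝 (cov[fun ω => centeredProduct P (fun ω => A (Z₀ ω)) (fun ω => b (Z₀ ω)) ω a,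
        fun ω => centeredProduct P (fun ω => A (Z₀ ω)) (fun ω => b' (Z₀ ω)) ω a'; P])) := by
  rw [covariance_eq_sub (memLp_two_centeredProduct hA4 hb4 a)
    (memLp_two_centeredProduct hA4 hb4' a')]
  exact (tendsto_avg_sampleProduct_mul hid hind hn hA hb hb' hA4 hb4 hb4' hcA hcb hcb' a a').sub
    ((tendsto_avg_sampleProduct hid hind hn hA hb hA4 hb4 hcA hcb a).mul
      (tendsto_avg_sampleProduct hid hind hn hA hb' hA4 hb4' hcA hcb' a'))

lemma tendsto_sampleCovMat (hid : ∀ i, IdentDistrib (Z i) Z₀ P P) (hind : iIndepFun Z P)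
    (hn : Tendsto n atTop atTop) {p q : ℕ} {A : E → Fin p → ℝ} {B : E → Fin q → ℝ}
    (hA : ∀ a, Measurable fun z => A z a) (hB : ∀ u, Measurable fun z => B z u)
    (hA4 : ∀ a, MemLp (fun ω => A (Z₀ ω) a) 4 P) (hB4 : ∀ u, MemLp (fun ω => B (Z₀ ω) u) 4 P)
    {c : Centering} (hcA : c = Centering.population → ∀ a, ∫ ω, A (Z₀ ω) a ∂P = 0)
    (hcB : c = Centering.population → ∀ u, ∫ ω, B (Z₀ ω) u ∂P = 0) :
    Tendsto (fun x : ℕ × Ω => sampleCovMat c (n x.1) (fun i => A (Z i x.2))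
      (fun i => B (Z i x.2))) (probFilter P)
      (𝓝 (crossCov P (fun ω => A (Z₀ ω)) (fun ω => B (Z₀ ω)))) := by
  refine tendsto_pi_nhds.2 fun a => tendsto_pi_nhds.2 fun u => ?_
  have h := tendsto_avg_sampleProduct hid hind hn hA (hB u) hA4 (hB4 u) hcA (fun h => hcB h u) a
  simp only [sampleCovMat, sampleCovVec, crossCov, Matrix.of_apply, avg_apply, covariance]
  simpa only [centeredProduct, mul_comm] using h

/-- Sample and population covariance are the same quadratic form, in `b` and `β` respectively;
coefficients and arguments converge separately. -/
lemma tendsto_sampleVar_dotProduct (hid : ∀ i, IdentDistrib (Z i) Z₀ P P) (hind : iIndepFun Z P)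
    (hn : Tendsto n atTop atTop) {p q : ℕ} {A : E → Fin p → ℝ} {B : E → Fin q → ℝ}
    (hA : ∀ a, Measurable fun z => A z a) (hB : ∀ u, Measurable fun z => B z u)
    (hA4 : ∀ a, MemLp (fun ω => A (Z₀ ω) a) 4 P) (hB4 : ∀ u, MemLp (fun ω => B (Z₀ ω) u) 4 P)
    {c : Centering} (hcA : c = Centering.population → ∀ a, ∫ ω, A (Z₀ ω) a ∂P = 0)
    (hcB : c = Centering.population → ∀ u, ∫ ω, B (Z₀ ω) u ∂P = 0)
    {b : ℕ × Ω → Fin q → ℝ} {β : Fin q → ℝ} (hb : Tendsto b (probFilter P) (𝓝 β)) :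
    Tendsto (fun x : ℕ × Ω => sampleVar (n x.1) (sampleProduct c (n x.1) (fun i => A (Z i x.2))
      (fun i => B (Z i x.2) ⬝ᵥ b x))) (probFilter P)
      (𝓝 (crossCov P (centeredProduct P (fun ω => A (Z₀ ω)) fun ω => B (Z₀ ω) ⬝ᵥ β)
        (centeredProduct P (fun ω => A (Z₀ ω)) fun ω => B (Z₀ ω) ⬝ᵥ β))) := by
  refine tendsto_pi_nhds.2 fun a => tendsto_pi_nhds.2 fun a' => ?_
  simp_rw [sampleVar_dotProduct]
  have hlin : ∀ a, (fun ω => centeredProduct P (fun ω => A (Z₀ ω))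
      (fun ω => B (Z₀ ω) ⬝ᵥ β) ω a) = fun ω => ∑ u, β u *
        centeredProduct P (fun ω => A (Z₀ ω)) (fun ω => B (Z₀ ω) u) ω a := by
    intro a
    ext ω
    simp only [centeredProduct, dotProduct]
    rw [integral_finsetSum _ fun u _ => ((hB4 u).integrable (by norm_num)).mul_const _,
      ← Finset.sum_sub_distrib, Finset.sum_mul]
    refine Finset.sum_congr rfl fun u _ => ?_
    rw [integral_mul_const]
    ring
  have hlim : crossCov P (centeredProduct P (fun ω => A (Z₀ ω)) fun ω => B (Z₀ ω) ⬝ᵥ β)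
        (centeredProduct P (fun ω => A (Z₀ ω)) fun ω => B (Z₀ ω) ⬝ᵥ β) a a' =
      ∑ u, ∑ v, β u * β v *
        cov[fun ω => centeredProduct P (fun ω => A (Z₀ ω)) (fun ω => B (Z₀ ω) u) ω a,
          fun ω => centeredProduct P (fun ω => A (Z₀ ω)) (fun ω => B (Z₀ ω) v) ω a'; P] := by
    rw [crossCov, Matrix.of_apply, hlin, hlin, covariance_fun_sum_fun_sum
      (fun u => (memLp_two_centeredProduct hA4 (hB4 u) a).const_mul _)
      (fun u => (memLp_two_centeredProduct hA4 (hB4 u) a').const_mul _)]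
    refine Finset.sum_congr rfl fun u _ => Finset.sum_congr rfl fun v _ => ?_
    rw [covariance_const_mul_left, covariance_const_mul_right, mul_assoc]
  rw [hlim]
  have hbu := tendsto_pi_nhds.1 hb
  exact tendsto_finsetSum _ fun u _ => tendsto_finsetSum _ fun v _ =>
    ((hbu u).mul (hbu v)).mul (tendsto_sample_covariance hid hind hn hA (hB u) (hB v) hA4
      (hB4 u) (hB4 v) hcA (fun h => hcB h u) (fun h => hcB h v) a a')

lemma tendsto_sampleVar (hid : ∀ i, IdentDistrib (Z i) Z₀ P P) (hind : iIndepFun Z P)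
    (hn : Tendsto n atTop atTop) {p : ℕ} {A : E → Fin p → ℝ} {b : E → ℝ}
    (hA : ∀ a, Measurable fun z => A z a) (hb : Measurable b)
    (hA4 : ∀ a, MemLp (fun ω => A (Z₀ ω) a) 4 P) (hb4 : MemLp (fun ω => b (Z₀ ω)) 4 P)
    {c : Centering} (hcA : c = Centering.population → ∀ a, ∫ ω, A (Z₀ ω) a ∂P = 0)
    (hcb : c = Centering.population → ∫ ω, b (Z₀ ω) ∂P = 0) :
    Tendsto (fun x : ℕ × Ω => sampleVar (n x.1) (sampleProduct c (n x.1) (fun i => A (Z i x.2))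
      (fun i => b (Z i x.2)))) (probFilter P)
      (𝓝 (crossCov P (centeredProduct P (fun ω => A (Z₀ ω)) fun ω => b (Z₀ ω))
        (centeredProduct P (fun ω => A (Z₀ ω)) fun ω => b (Z₀ ω)))) := by
  refine tendsto_pi_nhds.2 fun a => tendsto_pi_nhds.2 fun a' => ?_
  simp_rw [sampleVar_apply]
  exact tendsto_sample_covariance hid hind hn hA hb hb hA4 hb4 hb4 hcA hcb hcb a a'

end LawOfLargeNumbers

/-! ### Central limit theorems via characteristic functions. -/

section CentralLimit

variable {Ω E E' : Type*} [MeasurableSpace Ω] [MeasurableSpace E] [MeasurableSpace E']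
  {P : Measure Ω} [IsProbabilityMeasure P]

/-- Lévy's continuity theorem with a real variance parameter; `v = 0`, the point mass, is included,
so degenerate directions need no special care. -/
lemma tendstoInDistribution_gaussianReal_iff {X : ℕ → Ω → ℝ} (hX : ∀ k, AEMeasurable (X k) P)
    {v : ℝ} (hv : 0 ≤ v) :
    TendstoInDistribution X atTop (id : ℝ → ℝ) (fun _ => P) (gaussianReal 0 v.toNNReal) ↔
      ∀ t : ℝ, Tendsto (fun k => charFun (P.map (X k)) t) atTop
        (𝓝 (Complex.exp (-(v * t ^ 2 / 2)))) := by
  have key : ∀ t : ℝ, charFun ((gaussianReal 0 v.toNNReal).map id) t =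
      Complex.exp (-(v * t ^ 2 / 2)) := by
    intro t
    rw [Measure.map_id, charFun_gaussianReal]
    simp [hv]
  constructor
  · intro h t
    have := ProbabilityMeasure.tendsto_iff_tendsto_charFun.1 h.tendsto t
    rw [← key]
    exact this
  · intro h
    refine ⟨hX, aemeasurable_id, ProbabilityMeasure.tendsto_iff_tendsto_charFun.2 fun t => ?_⟩
    have := h t
    rw [← key] at this
    exact this

lemma tendsto_charFun_mul_of_tendstoInDistribution {X : ℕ → Ω → ℝ} {v : ℝ} (hv : 0 ≤ v)
    (h : TendstoInDistribution X atTop (id : ℝ → ℝ) (fun _ => P) (gaussianReal 0 v.toNNReal))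
    {r : ℕ → ℝ} {ρ : ℝ} (hr : Tendsto r atTop (𝓝 ρ)) (t : ℝ) :
    Tendsto (fun k => charFun (P.map fun ω => r k * X k ω) t) atTop
      (𝓝 (Complex.exp (-(ρ ^ 2 * v * t ^ 2 / 2)))) := by
  -- A deterministic sequence converges in probability, so Slutsky's theorem handles the rescaling.
  have hr' : TendstoInMeasure P (fun k _ => r k) atTop fun _ : Ω => ρ :=
    tendsto_probFilter_iff_tendstoInMeasure.1 (hr.comp tendsto_fst_probFilter)
  have h1 := TendstoInDistribution.continuous_comp_prodMk_of_tendstoInMeasure_const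
    (g := fun p : ℝ × ℝ => p.2 * p.1) (by fun_prop) h hr' fun k => aemeasurable_const
  have h2 := ProbabilityMeasure.tendsto_iff_tendsto_charFun.1 h1.tendsto t
  have key : charFun ((gaussianReal 0 v.toNNReal).map fun x => ρ * id x) t =
      Complex.exp (-(ρ ^ 2 * v * t ^ 2 / 2)) := by
    rw [charFun_map_mul_comp aemeasurable_id, Measure.map_id, charFun_gaussianReal]
    simp only [Complex.ofReal_mul, Complex.ofReal_zero, mul_zero, zero_mul, zero_sub]
    congr 2
    have : ((v.toNNReal : ℝ) : ℂ) = v := by rw [Real.coe_toNNReal _ hv]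
    rw [this]
    ring
  rw [← key]
  exact h2

lemma tendstoInDistribution_sqrt_mul_avg {Z : ℕ → Ω → E} {Z₀ : Ω → E}
    (hid : ∀ i, IdentDistrib (Z i) Z₀ P P) (hind : iIndepFun Z P) {f : E → ℝ} (hf : Measurable f)
    (hf2 : MemLp (fun ω => f (Z₀ ω)) 2 P) {n : ℕ → ℕ} (hn : Tendsto n atTop atTop) :
    TendstoInDistribution
      (fun k ω => √(n k : ℝ) * (avg (n k) (fun i => f (Z i ω)) - ∫ ω, f (Z₀ ω) ∂P)) atTop
      (id : ℝ → ℝ) (fun _ => P) (gaussianReal 0 Var[fun ω => f (Z₀ ω); P].toNNReal) := by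
  have hid' : ∀ i, IdentDistrib (fun ω => f (Z i ω)) (fun ω => f (Z₀ ω)) P P :=
    fun i => (hid i).comp hf
  have h := tendstoInDistribution_inv_sqrt_mul_sum_sub (P := P) (X := fun i ω => f (Z i ω))
    (Y := id) (P' := gaussianReal 0 Var[fun ω => f (Z 0 ω); P].toNNReal)
    ⟨aemeasurable_id, Measure.map_id⟩ ((hid' 0).memLp_iff.2 hf2)
    (hind.comp (fun _ => f) fun _ => hf) fun i => (hid' i).trans (hid' 0).symm
  rw [(hid' 0).variance_eq, (hid' 0).integral_eq] at h
  have hfun : (fun k ω => √(n k : ℝ) * (avg (n k) (fun i => f (Z i ω)) - ∫ ω, f (Z₀ ω) ∂P)) =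
      fun k ω => (√(n k : ℝ))⁻¹ *
        (∑ i ∈ Finset.range (n k), f (Z i ω) - n k * ∫ ω, f (Z₀ ω) ∂P) := by
    ext k ω
    rcases Nat.eq_zero_or_pos (n k) with h0 | h0
    · simp [h0]
    · have h1 : (0 : ℝ) < n k := by exact_mod_cast h0
      have h2 : √(n k : ℝ) ≠ 0 := (Real.sqrt_pos.2 h1).ne'
      have h3 : √(n k : ℝ) = (√(n k : ℝ))⁻¹ * n k := by
        rw [eq_inv_mul_iff_mul_eq₀ h2, Real.mul_self_sqrt h1.le]
      rw [avg, smul_eq_mul]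
      conv_lhs => rw [h3]
      rw [mul_assoc, mul_sub, mul_inv_cancel_left₀ h1.ne']
  rw [hfun]
  exact ⟨fun k => h.forall_aemeasurable (n k), aemeasurable_id, h.tendsto.comp hn⟩

/-- The central limit theorem for the difference of two independent sample means. -/
lemma tendstoInDistribution_sqrt_mul_avg_sub_avg {Z : ℕ → Ω → E} {Z₀ : Ω → E} {Z' : ℕ → Ω → E'}
    {Z₀' : Ω → E'} (hid : ∀ i, IdentDistrib (Z i) Z₀ P P) (hind : iIndepFun Z P)
    (hid' : ∀ i, IdentDistrib (Z' i) Z₀' P P) (hind' : iIndepFun Z' P)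
    (hindep : IndepFun (fun ω i => Z i ω) (fun ω i => Z' i ω) P)
    {f : E → ℝ} (hf : Measurable f) (hf2 : MemLp (fun ω => f (Z₀ ω)) 2 P)
    {f' : E' → ℝ} (hf' : Measurable f') (hf2' : MemLp (fun ω => f' (Z₀' ω)) 2 P)
    (hmean : ∫ ω, f (Z₀ ω) ∂P = ∫ ω, f' (Z₀' ω) ∂P)
    {n nt : ℕ → ℕ} (hn : Tendsto n atTop atTop) (hnt : Tendsto nt atTop atTop) {τ τt : ℝ}
    (hτ : 0 < τ) (hτt : 0 < τt)
    (hτlim : Tendsto (fun k => (n k : ℝ) / ((n k + nt k : ℕ) : ℝ)) atTop (𝓝 τ))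
    (hτtlim : Tendsto (fun k => (nt k : ℝ) / ((n k + nt k : ℕ) : ℝ)) atTop (𝓝 τt)) :
    TendstoInDistribution
      (fun k ω => √((n k + nt k : ℕ) : ℝ) *
        (avg (n k) (fun i => f (Z i ω)) - avg (nt k) (fun i => f' (Z' i ω)))) atTop
      (id : ℝ → ℝ) (fun _ => P) (gaussianReal 0
        (τ⁻¹ * Var[fun ω => f (Z₀ ω); P] + τt⁻¹ * Var[fun ω => f' (Z₀' ω); P]).toNNReal) := by
  have h1 := tendstoInDistribution_sqrt_mul_avg hid hind hf hf2 hn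
  have h2 := tendstoInDistribution_sqrt_mul_avg hid' hind' hf' hf2' hnt
  have hm1 : ∀ k, AEMeasurable (fun ω => avg (n k) (fun i => f (Z i ω))) P := fun k => by
    simp only [avg, smul_eq_mul]
    exact (Finset.aemeasurable_fun_sum _ fun i _ =>
      hf.comp_aemeasurable (hid i).aemeasurable_fst).const_mul _
  have hm2 : ∀ k, AEMeasurable (fun ω => avg (nt k) (fun i => f' (Z' i ω))) P := fun k => by
    simp only [avg, smul_eq_mul]
    exact (Finset.aemeasurable_fun_sum _ fun i _ =>
      hf'.comp_aemeasurable (hid' i).aemeasurable_fst).const_mul _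
  have hv1 := variance_nonneg (fun ω => f (Z₀ ω)) P
  have hv2 := variance_nonneg (fun ω => f' (Z₀' ω)) P
  refine (tendstoInDistribution_gaussianReal_iff (fun k => ((hm1 k).sub (hm2 k)).const_mul _)
    (by positivity)).2 fun t => ?_
  -- The two means have different natural scalings; `√N = √(N / n) · √n` turns each into its own
  -- limit theorem times a converging factor, whose square is the weight `τ⁻¹` or `τt⁻¹`.
  have hr1 : Tendsto (fun k => √(((n k : ℝ) / ((n k + nt k : ℕ) : ℝ))⁻¹)) atTop (𝓝 √τ⁻¹) :=
    (hτlim.inv₀ hτ.ne').sqrt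
  have hr2 : Tendsto (fun k => -√(((nt k : ℝ) / ((n k + nt k : ℕ) : ℝ))⁻¹)) atTop (𝓝 (-√τt⁻¹)) :=
    (hτtlim.inv₀ hτt.ne').sqrt.neg
  have h3 := (tendsto_charFun_mul_of_tendstoInDistribution hv1 h1 hr1 t).mul
    (tendsto_charFun_mul_of_tendstoInDistribution hv2 h2 hr2 t)
  have hlim : Complex.exp (-((√τ⁻¹ : ℝ) ^ 2 * Var[fun ω => f (Z₀ ω); P] * t ^ 2 / 2)) *
      Complex.exp (-(((-√τt⁻¹ : ℝ) : ℂ) ^ 2 * Var[fun ω => f' (Z₀' ω); P] * t ^ 2 / 2)) =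
      Complex.exp (-(((τ⁻¹ * Var[fun ω => f (Z₀ ω); P] +
        τt⁻¹ * Var[fun ω => f' (Z₀' ω); P] : ℝ) : ℂ) * t ^ 2 / 2)) := by
    have e1 : ((√τ⁻¹ : ℝ) : ℂ) ^ 2 = ((τ⁻¹ : ℝ) : ℂ) := by
      rw [← Complex.ofReal_pow, Real.sq_sqrt (by positivity)]
    have e2 : ((-√τt⁻¹ : ℝ) : ℂ) ^ 2 = ((τt⁻¹ : ℝ) : ℂ) := by
      rw [← Complex.ofReal_pow, neg_sq, Real.sq_sqrt (by positivity)]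
    rw [e1, e2, ← Complex.exp_add]
    congr 1
    push_cast
    ring
  rw [hlim] at h3
  refine h3.congr' ?_
  filter_upwards [hn.eventually_gt_atTop 0, hnt.eventually_gt_atTop 0] with k hk hkt
  -- The two terms are functions of different samples, so the characteristic function of their sum
  -- factors at each fixed `k`.
  have hind2 : IndepFun
      (fun ω => √(((n k : ℝ) / ((n k + nt k : ℕ) : ℝ))⁻¹) *
        (√(n k : ℝ) * (avg (n k) (fun i => f (Z i ω)) - ∫ ω, f (Z₀ ω) ∂P)))
      (fun ω => -√(((nt k : ℝ) / ((n k + nt k : ℕ) : ℝ))⁻¹) *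
        (√(nt k : ℝ) * (avg (nt k) (fun i => f' (Z' i ω)) - ∫ ω, f' (Z₀' ω) ∂P))) P := by
    refine hindep.comp
      (φ := fun z : ℕ → E => √(((n k : ℝ) / ((n k + nt k : ℕ) : ℝ))⁻¹) *
        (√(n k : ℝ) * (avg (n k) (fun i => f (z i)) - ∫ ω, f (Z₀ ω) ∂P)))
      (ψ := fun z : ℕ → E' => -√(((nt k : ℝ) / ((n k + nt k : ℕ) : ℝ))⁻¹) *
        (√(nt k : ℝ) * (avg (nt k) (fun i => f' (z i)) - ∫ ω, f' (Z₀' ω) ∂P))) ?_ ?_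
    · simp only [avg, smul_eq_mul]
      fun_prop
    · simp only [avg, smul_eq_mul]
      fun_prop
  rw [← Pi.mul_apply, ← hind2.charFun_map_fun_add_eq_mul
    ((((hm1 k).sub_const _).const_mul _).const_mul _)
    ((((hm2 k).sub_const _).const_mul _).const_mul _)]
  have hnpos : (0 : ℝ) < n k := by exact_mod_cast hk
  have hntpos : (0 : ℝ) < nt k := by exact_mod_cast hkt
  have e1 : √(((n k : ℝ) / ((n k + nt k : ℕ) : ℝ))⁻¹) * √(n k : ℝ) =
      √((n k + nt k : ℕ) : ℝ) := by
    rw [← Real.sqrt_mul (by positivity), inv_div, div_mul_cancel₀ _ hnpos.ne']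
  have e2 : √(((nt k : ℝ) / ((n k + nt k : ℕ) : ℝ))⁻¹) * √(nt k : ℝ) =
      √((n k + nt k : ℕ) : ℝ) := by
    rw [← Real.sqrt_mul (by positivity), inv_div, div_mul_cancel₀ _ hntpos.ne']
  congr 2
  ext ω
  rw [Pi.sub_apply, neg_mul, ← mul_assoc, ← mul_assoc, e1, e2, hmean]
  ring

/-- **Cramér–Wold** for Gaussian limits. -/
lemma tendstoInDistribution_multivariateGaussian {d : ℕ} {X : ℕ → Ω → EuclideanSpace ℝ (Fin d)}
    (hX : ∀ k, AEMeasurable (X k) P) {V : Matrix (Fin d) (Fin d) ℝ} (hV : V.PosSemidef)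
    (h : ∀ s : Fin d → ℝ, TendstoInDistribution (fun k ω => s ⬝ᵥ (X k ω).ofLp) atTop
      (id : ℝ → ℝ) (fun _ => P) (gaussianReal 0 (s ⬝ᵥ (V *ᵥ s)).toNNReal)) :
    TendstoInDistribution X atTop
      (id : EuclideanSpace ℝ (Fin d) → EuclideanSpace ℝ (Fin d)) (fun _ => P)
      (multivariateGaussian 0 V) := by
  refine ⟨hX, aemeasurable_id, ProbabilityMeasure.tendsto_iff_tendsto_charFun.2 fun s => ?_⟩
  have hnn : 0 ≤ s.ofLp ⬝ᵥ (V *ᵥ s.ofLp) := by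
    have := hV.dotProduct_mulVec_nonneg s.ofLp
    rwa [star_trivial] at this
  have h1 := (tendstoInDistribution_gaussianReal_iff (h s.ofLp).forall_aemeasurable hnn).1
    (h s.ofLp) 1
  have h2 : charFun ((multivariateGaussian 0 V).map id) s =
      Complex.exp (-(((s.ofLp ⬝ᵥ (V *ᵥ s.ofLp) : ℝ) : ℂ) * (1 : ℝ) ^ 2 / 2)) := by
    rw [Measure.map_id, charFun_multivariateGaussian hV]
    simp
  -- The characteristic function of the vector at `s` is that of its projection on `s` at 1.
  have h3 : ∀ k, charFun (P.map (X k)) s = charFun (P.map fun ω => s.ofLp ⬝ᵥ (X k ω).ofLp) 1 := by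
    intro k
    rw [charFun_apply, charFun_apply, integral_map (hX k) (by fun_prop),
      integral_map ((h s.ofLp).forall_aemeasurable k) (by fun_prop)]
    simp [PiLp.inner_apply, dotProduct]
  refine Tendsto.congr (fun k => (h3 k).symm) ?_
  exact h2 ▸ h1

end CentralLimit

/-! ### Coverage of studentized intervals. -/

section Coverage

lemma continuousAt_measureReal_Iic {ν : Measure ℝ} [IsProbabilityMeasure ν] {x : ℝ}
    (hx : ν {x} = 0) : ContinuousAt (fun r => ν.real (Set.Iic r)) x := by
  have h : ContinuousAt (cdf ν) x := by
    rw [(cdf ν).mono.continuousAt_iff_leftLim_eq_rightLim, (cdf ν).rightLim_eq]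
    have h1 := (cdf ν).measure_singleton x
    rw [measure_cdf, hx, eq_comm, ENNReal.ofReal_eq_zero] at h1
    exact le_antisymm ((cdf ν).mono.leftLim_le le_rfl) (by linarith)
  exact h.congr (Eventually.of_forall fun r => cdf_eq_real ν r)

lemma gaussianReal_real_Ioi (x : ℝ) :
    (gaussianReal 0 1).real (Set.Ioi x) = 1 - (gaussianReal 0 1).real (Set.Iic x) := by
  rw [← Set.compl_Iic, probReal_compl_eq_one_sub measurableSet_Iic]

lemma gaussianReal_real_Iio_neg (x : ℝ) :
    (gaussianReal 0 1).real (Set.Iio (-x)) = (gaussianReal 0 1).real (Set.Ioi x) := by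
  have h : (gaussianReal 0 1).map (fun x => -x) = gaussianReal 0 1 := by
    rw [gaussianReal_map_neg, neg_zero]
  conv_lhs => rw [← h]
  rw [map_measureReal_apply (by fun_prop) measurableSet_Iio]
  congr 1
  ext y
  simp

lemma gaussianReal_real_Icc {x : ℝ} (hx : 0 ≤ x) :
    (gaussianReal 0 1).real (Set.Icc (-x) x) = 2 * (gaussianReal 0 1).real (Set.Iic x) - 1 := by
  have h : Set.Icc (-x) x = Set.Iic x \ Set.Iio (-x) := by
    ext y
    simp [and_comm]
  rw [h, measureReal_sdiff (fun y hy => ?_) measurableSet_Iio, gaussianReal_real_Iio_neg,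
    gaussianReal_real_Ioi]
  · ring
  · exact (Set.mem_Iio.1 hy).le.trans (by linarith)

/-- By symmetry a point `z ≤ 0` has distribution function at most `1 / 2`, whereas `1 - α / 2 > 1 /
2`. -/
lemma pos_of_gaussianReal_real_Iic {z α : ℝ} (hα : α ∈ Set.Ioo (0 : ℝ) 1)
    (hz : (gaussianReal 0 1).real (Set.Iic z) = 1 - α / 2) : 0 < z := by
  by_contra hcon
  rw [not_lt] at hcon
  have h1 : (gaussianReal 0 1).real (Set.Iic z) ≤ (gaussianReal 0 1).real (Set.Iic (-z)) :=
    measureReal_mono (Set.Iic_subset_Iic.2 (by linarith))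
  have h2 := gaussianReal_real_Iio_neg (-z)
  rw [gaussianReal_real_Ioi, neg_neg] at h2
  have := nullSingletonClass_gaussianReal (μ := 0) (v := 1) one_ne_zero
  have h3 : (gaussianReal 0 1).real (Set.Iio z) = (gaussianReal 0 1).real (Set.Iic z) :=
    measureReal_congr Iio_ae_eq_Iic
  linarith [hα.2]

variable {Ω : Type*} [MeasurableSpace Ω] {P : Measure Ω} [IsProbabilityMeasure P]

/-- Turns an inclusion valid with probability tending to one into an inequality between
probabilities with vanishing error. No measurability of the events is needed. -/
lemma exists_measureReal_le_add_of_eventually {S A : ℕ → Set Ω}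
    (h : ∀ᶠ x in probFilter P, x.2 ∈ S x.1 → x.2 ∈ A x.1) :
    ∃ e : ℕ → ℝ, Tendsto e atTop (𝓝 0) ∧ ∀ k, P.real (S k) ≤ P.real (A k) + e k := by
  rw [eventually_probFilter] at h
  refine ⟨fun k => P.real {ω | ¬ (ω ∈ S k → ω ∈ A k)}, ?_, fun k => ?_⟩
  · exact (ENNReal.tendsto_toReal_zero_iff fun _ => measure_ne_top _ _).2 h
  · refine (measureReal_mono (fun ω hω => ?_) (measure_ne_top _ _)).trans
      (measureReal_union_le _ _)
    by_cases hA : ω ∈ A k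
    · exact Or.inl hA
    · exact Or.inr fun hcon => hA (hcon hω)

/-- Positive variance makes the limit law atomless, so the endpoints of the interval are null and
portmanteau applies; scaling by `√v` reduces it to the standard Gaussian. -/
lemma tendsto_measureReal_abs_le {T : ℕ → Ω → ℝ} {v : ℝ} (hv : 0 < v)
    (hT : TendstoInDistribution T atTop (id : ℝ → ℝ) (fun _ => P) (gaussianReal 0 v.toNNReal))
    {x : ℝ} (hx : 0 ≤ x) :
    Tendsto (fun k => P.real {ω | |T k ω| ≤ x * √v}) atTop
      (𝓝 (2 * (gaussianReal 0 1).real (Set.Iic x) - 1)) := by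
  have hvs : 0 < √v := Real.sqrt_pos.2 hv
  have hv' : v.toNNReal ≠ 0 := by simpa using hv
  have hset : ∀ k, {ω | |T k ω| ≤ x * √v} = T k ⁻¹' Set.Icc (-(x * √v)) (x * √v) := by
    intro k
    ext ω
    simp [abs_le]
  have hnull : (gaussianReal 0 v.toNNReal).map id
      (frontier (Set.Icc (-(x * √v)) (x * √v))) = 0 := by
    have := nullSingletonClass_gaussianReal (μ := 0) hv'
    rw [Measure.map_id, frontier_Icc (by nlinarith)]
    exact Set.Finite.measure_zero (by simp) _
  have h1 := ProbabilityMeasure.tendsto_measure_of_null_frontier_of_tendsto' hT.tendsto hnull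
  have h2 : (gaussianReal 0 v.toNNReal).map id (Set.Icc (-(x * √v)) (x * √v)) =
      gaussianReal 0 1 (Set.Icc (-x) x) := by
    have h3 : gaussianReal 0 v.toNNReal = (gaussianReal 0 1).map (√v * ·) := by
      rw [gaussianReal_map_const_mul]
      congr 1
      · simp
      · ext
        simp [hv.le]
    rw [Measure.map_id, h3, Measure.map_apply (by fun_prop) measurableSet_Icc]
    congr 1
    ext y
    simp only [Set.mem_preimage, Set.mem_Icc]
    constructor
    · rintro ⟨h4, h5⟩
      exact ⟨by nlinarith, by nlinarith⟩
    · rintro ⟨h4, h5⟩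
      exact ⟨by nlinarith, by nlinarith⟩
  rw [← gaussianReal_real_Icc hx]
  simp only [ProbabilityMeasure.coe_mk] at h1
  rw [h2] at h1
  refine ((ENNReal.tendsto_toReal (measure_ne_top _ _)).comp h1).congr fun k => ?_
  rw [hset, Function.comp_apply,
    Measure.map_apply_of_aemeasurable (hT.forall_aemeasurable k) measurableSet_Icc]
  rfl

/-- Studentization: symmetric intervals whose half-width is `z` times a consistent estimate of
the asymptotic standard deviation have asymptotic coverage `1 - α`. -/
lemma tendsto_measureReal_coverage {T : ℕ → Ω → ℝ} {v : ℝ} (hv : 0 < v)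
    (hT : TendstoInDistribution T atTop (id : ℝ → ℝ) (fun _ => P) (gaussianReal 0 v.toNNReal))
    {V : ℕ × Ω → ℝ} (hV : Tendsto V (probFilter P) (𝓝 v)) {z α : ℝ}
    (hα : α ∈ Set.Ioo (0 : ℝ) 1) (hz : (gaussianReal 0 1).real (Set.Iic z) = 1 - α / 2)
    {A : ℕ → Set Ω}
    (hA : ∀ᶠ x in probFilter P, x.2 ∈ A x.1 ↔ |T x.1 x.2| ≤ z * √(V x)) :
    Tendsto (fun k => P.real (A k)) atTop (𝓝 (1 - α)) := by
  have hz0 := pos_of_gaussianReal_real_Iic hα hz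
  have hvs : 0 < √v := Real.sqrt_pos.2 hv
  have := nullSingletonClass_gaussianReal (μ := 0) (v := 1) one_ne_zero
  have hcont : Tendsto (fun r => 2 * (gaussianReal 0 1).real (Set.Iic r) - 1) (𝓝 z)
      (𝓝 (1 - α)) := by
    have h := ((continuousAt_measureReal_Iic (ν := gaussianReal 0 1)
      (measure_singleton z)).tendsto.const_mul 2).sub_const (1 : ℝ)
    rw [hz] at h
    convert h using 2
    ring
  have hV' : Tendsto (fun x => z * √(V x)) (probFilter P) (𝓝 (z * √v)) := hV.sqrt.const_mul z
  refine tendsto_order.2 ⟨fun a ha => ?_, fun a ha => ?_⟩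
  -- The random radius `z * √(V x)` is squeezed between fixed ones. For `r` slightly below `z` the
  -- event `|T| ≤ r √v` implies coverage up to vanishing probability, and its limit exceeds `a` by
  -- continuity of the Gaussian distribution function. The upper bound uses `r` slightly above `z`.
  · obtain ⟨r, hr, hr0, hrz⟩ := (((hcont.mono_left nhdsWithin_le_nhds).eventually_const_lt ha).and
      (((eventually_gt_nhds hz0).filter_mono nhdsWithin_le_nhds).and
        (eventually_mem_nhdsWithin (s := Set.Iio z)))).exists
    have hlt : r * √v < z * √v := by
      have := Set.mem_Iio.1 hrz
      gcongr
    obtain ⟨e, he, hle⟩ := exists_measureReal_le_add_of_eventually (P := P)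
      (S := fun k => {ω | |T k ω| ≤ r * √v}) (A := A) (by
        filter_upwards [hA, hV'.eventually_const_lt hlt] with x h1 h2 h3
        exact h1.2 (le_trans h3 h2.le))
    have h4 := (tendsto_measureReal_abs_le hv hT hr0.le).sub he
    rw [sub_zero] at h4
    filter_upwards [h4.eventually_const_lt hr] with k hk
    linarith [hle k]
  · obtain ⟨r, hr, hr0, hrz⟩ := (((hcont.mono_left nhdsWithin_le_nhds).eventually_lt_const ha).and
      (((eventually_gt_nhds hz0).filter_mono nhdsWithin_le_nhds).and
        (eventually_mem_nhdsWithin (s := Set.Ioi z)))).exists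
    have hlt : z * √v < r * √v := by
      have := Set.mem_Ioi.1 hrz
      gcongr
    obtain ⟨e, he, hle⟩ := exists_measureReal_le_add_of_eventually (P := P)
      (S := A) (A := fun k => {ω | |T k ω| ≤ r * √v}) (by
        filter_upwards [hA, hV'.eventually_lt_const hlt] with x h1 h2 h3
        exact le_trans (h1.1 h3) h2.le)
    have h4 := (tendsto_measureReal_abs_le hv hT hr0.le).add he
    rw [add_zero] at h4
    filter_upwards [h4.eventually_lt_const hr] with k hk
    linarith [hle k]

end Coverage

/-! ### Asymptotic normality of the sample moments under either centring. -/

section MomentCLT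

/-- The difference between the sample covariance of data centred by their population means and
the one that uses the centring convention `c`. -/
noncomputable def centeringError (c : Centering) (n : ℕ) (u v : ℕ → ℝ) : ℝ :=
  match c with
  | .population => 0
  | .sample => avg n u * avg n v

/-- Centring by sample means is invariant under a shift of the data, so the population means may be
subtracted first; what remains is the product of the two averages. -/
lemma sampleCovVec_apply_eq {p : ℕ} (c : Centering) (n : ℕ) (A : ℕ → Fin p → ℝ) (b : ℕ → ℝ)
    (a : Fin p) {μA μb : ℝ} (hA : c = Centering.population → μA = 0)
    (hb : c = Centering.population → μb = 0) :
    sampleCovVec c n A b a = avg n (fun i => (b i - μb) * (A i a - μA)) -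
      centeringError c n (fun i => b i - μb) (fun i => A i a - μA) := by
  rw [sampleCovVec, avg_apply]
  simp_rw [sampleProduct_apply]
  cases c
  · simp [Centering.shift, centeringError, hA rfl, hb rfl]
  · simp only [Centering.shift, centeringError]
    rw [← avg_sub_avg_mul]
    rcases eq_or_ne n 0 with rfl | hn
    · simp [avg_zero]
    · rw [avg_sub, avg_sub, avg_const hn, avg_const hn]
      simp

variable {Ω E E' : Type*} [MeasurableSpace Ω] [MeasurableSpace E] [MeasurableSpace E']
  {P : Measure Ω} [IsProbabilityMeasure P]

lemma variance_dotProduct {p : ℕ} {A : Ω → Fin p → ℝ} (hA : ∀ a, MemLp (fun ω => A ω a) 2 P)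
    (t : Fin p → ℝ) : Var[fun ω => t ⬝ᵥ A ω; P] = t ⬝ᵥ (crossCov P A A *ᵥ t) := by
  simp only [dotProduct]
  rw [variance_fun_sum fun a => (hA a).const_mul (t a)]
  refine Finset.sum_congr rfl fun a _ => ?_
  rw [Matrix.mulVec, dotProduct, Finset.mul_sum]
  refine Finset.sum_congr rfl fun a' _ => ?_
  rw [covariance_const_mul_left, covariance_const_mul_right, crossCov, Matrix.of_apply]
  ring

lemma posSemidef_crossCov {p : ℕ} {A : Ω → Fin p → ℝ} (hA : ∀ a, MemLp (fun ω => A ω a) 2 P) :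
    (crossCov P A A).PosSemidef := by
  refine .of_dotProduct_mulVec_nonneg ?_ fun t => ?_
  · ext a a'
    simp [crossCov, covariance_comm]
  · rw [star_trivial, ← variance_dotProduct hA]
    exact variance_nonneg _ _

/-- One average scaled by `√n` is bounded in probability, the other tends to zero, and `N / n`
converges. -/
lemma tendsto_sqrt_mul_centeringError {Z : ℕ → Ω → E} {Z₀ : Ω → E}
    (hid : ∀ i, IdentDistrib (Z i) Z₀ P P) (hind : iIndepFun Z P)
    {f g : E → ℝ} (hf : Measurable f) (hf2 : MemLp (fun ω => f (Z₀ ω)) 2 P)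
    (hg : Measurable g) (hg2 : MemLp (fun ω => g (Z₀ ω)) 2 P)
    (hf0 : ∫ ω, f (Z₀ ω) ∂P = 0) (hg0 : ∫ ω, g (Z₀ ω) ∂P = 0)
    {n N : ℕ → ℕ} (hn : Tendsto n atTop atTop) {τ : ℝ} (hτ : 0 < τ)
    (hτlim : Tendsto (fun k => (n k : ℝ) / (N k : ℝ)) atTop (𝓝 τ)) (c : Centering) :
    Tendsto (fun x : ℕ × Ω => √(N x.1 : ℝ) * centeringError c (n x.1)
      (fun i => f (Z i x.2)) (fun i => g (Z i x.2))) (probFilter P) (𝓝 0) := by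
  cases c
  · simp only [centeringError, mul_zero]
    exact tendsto_const_nhds
  have h1 := bddInProb_of_tendstoInDistribution
    (tendstoInDistribution_sqrt_mul_avg hid hind hf hf2 hn)
  have h2 := tendsto_avg_probFilter hid hind hn hg (hg2.integrable (by norm_num))
  have h3 : Tendsto (fun k => √(((n k : ℝ) / (N k : ℝ))⁻¹)) atTop (𝓝 √τ⁻¹) :=
    (hτlim.inv₀ hτ.ne').sqrt
  have h4 := (h3.comp (tendsto_fst_probFilter (P := P))).mul h2
  rw [hg0, mul_zero] at h4
  have h5 := h1.tendsto_mul (h := fun k ω => √(((n k : ℝ) / (N k : ℝ))⁻¹) *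
    avg (n k) fun i => g (Z i ω)) h4
  refine h5.congr' ?_
  filter_upwards [tendsto_fst_probFilter.eventually (hn.eventually_gt_atTop 0)] with x hx
  have hnpos : (0 : ℝ) < n x.1 := by exact_mod_cast hx
  have e1 : √(((n x.1 : ℝ) / (N x.1 : ℝ))⁻¹) * √(n x.1 : ℝ) = √(N x.1 : ℝ) := by
    rw [← Real.sqrt_mul (by positivity), inv_div, div_mul_cancel₀ _ hnpos.ne']
  simp only [centeringError]
  rw [← e1, hf0, sub_zero]
  ring

lemma measurable_avg {f : E → ℝ} (hf : Measurable f) (n : ℕ) :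
    Measurable fun z : ℕ → E => avg n fun i => f (z i) := by
  simp only [avg, smul_eq_mul]
  fun_prop

lemma measurable_centeringError {f g : E → ℝ} (hf : Measurable f) (hg : Measurable g)
    (c : Centering) (n : ℕ) :
    Measurable fun z : ℕ → E => centeringError c n (fun i => f (z i)) (fun i => g (z i)) := by
  cases c
  · exact measurable_const
  · exact (measurable_avg hf n).mul (measurable_avg hg n)

/-- Asymptotic normality of the difference of two independent sample covariances with the same
population value. -/
lemma tendstoInDistribution_sampleCovVec_sub {Z : ℕ → Ω → E} {Z₀ : Ω → E} {Z' : ℕ → Ω → E'}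
    {Z₀' : Ω → E'} (hid : ∀ i, IdentDistrib (Z i) Z₀ P P) (hind : iIndepFun Z P)
    (hid' : ∀ i, IdentDistrib (Z' i) Z₀' P P) (hind' : iIndepFun Z' P)
    (hindep : IndepFun (fun ω i => Z i ω) (fun ω i => Z' i ω) P) {p : ℕ}
    {A : E → Fin p → ℝ} {b : E → ℝ} {A' : E' → Fin p → ℝ} {b' : E' → ℝ}
    (hA : ∀ a, Measurable fun z => A z a) (hb : Measurable b)
    (hA4 : ∀ a, MemLp (fun ω => A (Z₀ ω) a) 4 P) (hb4 : MemLp (fun ω => b (Z₀ ω)) 4 P)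
    (hA' : ∀ a, Measurable fun z => A' z a) (hb' : Measurable b')
    (hA4' : ∀ a, MemLp (fun ω => A' (Z₀' ω) a) 4 P) (hb4' : MemLp (fun ω => b' (Z₀' ω)) 4 P)
    {c : Centering} (hcA : c = Centering.population → ∀ a, ∫ ω, A (Z₀ ω) a ∂P = 0)
    (hcb : c = Centering.population → ∫ ω, b (Z₀ ω) ∂P = 0)
    (hcA' : c = Centering.population → ∀ a, ∫ ω, A' (Z₀' ω) a ∂P = 0)
    (hcb' : c = Centering.population → ∫ ω, b' (Z₀' ω) ∂P = 0)
    (hmean : ∀ a, ∫ ω, centeredProduct P (fun ω => A (Z₀ ω)) (fun ω => b (Z₀ ω)) ω a ∂P =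
      ∫ ω, centeredProduct P (fun ω => A' (Z₀' ω)) (fun ω => b' (Z₀' ω)) ω a ∂P)
    {n nt : ℕ → ℕ} (hn : Tendsto n atTop atTop) (hnt : Tendsto nt atTop atTop) {τ τt : ℝ}
    (hτ : 0 < τ) (hτt : 0 < τt)
    (hτlim : Tendsto (fun k => (n k : ℝ) / ((n k + nt k : ℕ) : ℝ)) atTop (𝓝 τ))
    (hτtlim : Tendsto (fun k => (nt k : ℝ) / ((n k + nt k : ℕ) : ℝ)) atTop (𝓝 τt))
    (t : Fin p → ℝ) :
    TendstoInDistribution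
      (fun k ω => √((n k + nt k : ℕ) : ℝ) * (t ⬝ᵥ
        (sampleCovVec c (n k) (fun i => A (Z i ω)) (fun i => b (Z i ω)) -
          sampleCovVec c (nt k) (fun i => A' (Z' i ω)) (fun i => b' (Z' i ω))))) atTop
      (id : ℝ → ℝ) (fun _ => P) (gaussianReal 0 (t ⬝ᵥ
        ((τ⁻¹ • crossCov P (centeredProduct P (fun ω => A (Z₀ ω)) fun ω => b (Z₀ ω))
            (centeredProduct P (fun ω => A (Z₀ ω)) fun ω => b (Z₀ ω)) +
          τt⁻¹ • crossCov P (centeredProduct P (fun ω => A' (Z₀' ω)) fun ω => b' (Z₀' ω))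
            (centeredProduct P (fun ω => A' (Z₀' ω)) fun ω => b' (Z₀' ω))) *ᵥ t)).toNNReal) := by
  have hN : ∀ {F : Ω → ℝ}, MemLp F 4 P → MemLp (fun ω => F ω - ∫ ω, F ω ∂P) 2 P :=
    fun h => (h.mono_exponent (by norm_num)).sub (memLp_const _)
  have hzero : ∀ {F : Ω → ℝ}, MemLp F 4 P → ∫ ω, (F ω - ∫ ω, F ω ∂P) ∂P = 0 := fun h => by
    rw [integral_sub (h.integrable (by norm_num)) (integrable_const _)]
    simp
  set μA : Fin p → ℝ := fun a => ∫ ω, A (Z₀ ω) a ∂P with hμA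
  set μb : ℝ := ∫ ω, b (Z₀ ω) ∂P with hμb
  set μA' : Fin p → ℝ := fun a => ∫ ω, A' (Z₀' ω) a ∂P with hμA'
  set μb' : ℝ := ∫ ω, b' (Z₀' ω) ∂P with hμb'
  have hA0 : ∀ a, Measurable fun z => A z a - μA a := fun a => (hA a).sub_const _
  have hA0' : ∀ a, Measurable fun z => A' z a - μA' a := fun a => (hA' a).sub_const _
  have hb0 : Measurable fun z => b z - μb := hb.sub_const _
  have hb0' : Measurable fun z => b' z - μb' := hb'.sub_const _
  have hcp := memLp_two_centeredProduct hA4 hb4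
  have hcp' := memLp_two_centeredProduct hA4' hb4'
  have hsum : ∫ ω, t ⬝ᵥ centeredProduct P (fun ω => A (Z₀ ω)) (fun ω => b (Z₀ ω)) ω ∂P =
      ∫ ω, t ⬝ᵥ centeredProduct P (fun ω => A' (Z₀' ω)) (fun ω => b' (Z₀' ω)) ω ∂P := by
    simp only [dotProduct]
    rw [integral_finsetSum _ fun a _ => ((hcp a).integrable (by norm_num)).const_mul (t a),
      integral_finsetSum _ fun a _ => ((hcp' a).integrable (by norm_num)).const_mul (t a)]
    refine Finset.sum_congr rfl fun a _ => ?_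
    rw [integral_const_mul, integral_const_mul, hmean a]
  have hclt := tendstoInDistribution_sqrt_mul_avg_sub_avg hid hind hid' hind' hindep
    (f := fun z => t ⬝ᵥ fun a => (b z - μb) * (A z a - μA a))
    (f' := fun z => t ⬝ᵥ fun a => (b' z - μb') * (A' z a - μA' a))
    (Finset.measurable_sum _ fun a _ => (hb0.mul (hA0 a)).const_mul _)
    (memLp_finsetSum _ fun a _ => (hcp a).const_mul (t a))
    (Finset.measurable_sum _ fun a _ => (hb0'.mul (hA0' a)).const_mul _)
    (memLp_finsetSum _ fun a _ => (hcp' a).const_mul (t a))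
    hsum hn hnt hτ hτt hτlim hτtlim
  have hvar : Var[fun ω => t ⬝ᵥ fun a => (b (Z₀ ω) - μb) * (A (Z₀ ω) a - μA a); P] = _ :=
    variance_dotProduct (A := centeredProduct P (fun ω => A (Z₀ ω)) fun ω => b (Z₀ ω)) hcp t
  have hvar' : Var[fun ω => t ⬝ᵥ fun a => (b' (Z₀' ω) - μb') * (A' (Z₀' ω) a - μA' a); P] = _ :=
    variance_dotProduct (A := centeredProduct P (fun ω => A' (Z₀' ω)) fun ω => b' (Z₀' ω)) hcp' t
  rw [hvar, hvar'] at hclt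
  rw [Matrix.add_mulVec, Matrix.smul_mulVec, Matrix.smul_mulVec, dotProduct_add, dotProduct_smul,
    dotProduct_smul, smul_eq_mul, smul_eq_mul]
  -- The statistic splits into the version centred by population means, to which the two-sample
  -- theorem applies, and centring errors that vanish in probability.
  have hexp : ∀ k ω, √((n k + nt k : ℕ) : ℝ) * (t ⬝ᵥ
        (sampleCovVec c (n k) (fun i => A (Z i ω)) (fun i => b (Z i ω)) -
          sampleCovVec c (nt k) (fun i => A' (Z' i ω)) (fun i => b' (Z' i ω)))) =
      √((n k + nt k : ℕ) : ℝ) *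
        (avg (n k) (fun i => t ⬝ᵥ fun a => (b (Z i ω) - μb) * (A (Z i ω) a - μA a)) -
          avg (nt k) (fun i => t ⬝ᵥ fun a => (b' (Z' i ω) - μb') * (A' (Z' i ω) a - μA' a))) +
      ∑ a, t a * (√((n k + nt k : ℕ) : ℝ) * centeringError c (nt k)
          (fun i => b' (Z' i ω) - μb') (fun i => A' (Z' i ω) a - μA' a) -
        √((n k + nt k : ℕ) : ℝ) * centeringError c (n k)
          (fun i => b (Z i ω) - μb) (fun i => A (Z i ω) a - μA a)) := by
    intro k ω
    simp only [dotProduct, Pi.sub_apply]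
    rw [avg_sum, avg_sum, ← Finset.sum_sub_distrib, Finset.mul_sum, Finset.mul_sum,
      ← Finset.sum_add_distrib]
    refine Finset.sum_congr rfl fun a _ => ?_
    rw [sampleCovVec_apply_eq c (n k) _ _ a (fun h => hcA h a) hcb,
      sampleCovVec_apply_eq c (nt k) _ _ a (fun h => hcA' h a) hcb', avg_const_mul, avg_const_mul]
    ring
  have herr : Tendsto (fun x : ℕ × Ω => ∑ a, t a *
      (√((n x.1 + nt x.1 : ℕ) : ℝ) * centeringError c (nt x.1)
          (fun i => b' (Z' i x.2) - μb') (fun i => A' (Z' i x.2) a - μA' a) -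
        √((n x.1 + nt x.1 : ℕ) : ℝ) * centeringError c (n x.1)
          (fun i => b (Z i x.2) - μb) (fun i => A (Z i x.2) a - μA a))) (probFilter P) (𝓝 0) := by
    have h0 : (0 : ℝ) = ∑ a, t a * (0 - 0) := by simp
    rw [h0]
    refine tendsto_finsetSum _ fun a _ => (Tendsto.sub ?_ ?_).const_mul _
    · exact tendsto_sqrt_mul_centeringError hid' hind' hb0' (hN hb4') (hA0' a) (hN (hA4' a))
        (hzero hb4') (hzero (hA4' a)) hnt hτt hτtlim c
    · exact tendsto_sqrt_mul_centeringError hid hind hb0 (hN hb4) (hA0 a) (hN (hA4 a))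
        (hzero hb4) (hzero (hA4 a)) hn hτ hτlim c
  have hZm : AEMeasurable (fun ω i => Z i ω) P :=
    aemeasurable_pi_lambda _ fun i => (hid i).aemeasurable_fst
  have hZm' : AEMeasurable (fun ω i => Z' i ω) P :=
    aemeasurable_pi_lambda _ fun i => (hid' i).aemeasurable_fst
  refine tendstoInDistribution_of_tendstoInMeasure_sub _ _ hclt ?_ fun k => ?_
  · refine tendsto_probFilter_iff_tendstoInMeasure.1 (herr.congr fun x => ?_)
    simp only [Pi.sub_apply]
    rw [hexp]
    ring
  · simp_rw [hexp]
    refine (hclt.forall_aemeasurable k).add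
      (Finset.aemeasurable_fun_sum _ fun a _ => (AEMeasurable.sub ?_ ?_).const_mul _)
    · exact ((measurable_centeringError hb0' (hA0' a) c (nt k)).comp_aemeasurable hZm').const_mul _
    · exact ((measurable_centeringError hb0 (hA0 a) c (n k)).comp_aemeasurable hZm).const_mul _

end MomentCLT

/-! ### The population moment condition. -/

section Exogeneity

variable {Ω : Type*} [MeasurableSpace Ω] {P : Measure Ω}

lemma integral_centeredProduct {p : ℕ} (A : Ω → Fin p → ℝ) (b : Ω → ℝ) (a : Fin p) :
    ∫ ω, centeredProduct P A b ω a ∂P = cov[fun ω => A ω a, b; P] := by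
  rw [covariance_comm]
  rfl

lemma crossCov_mulVec_apply [IsProbabilityMeasure P] {p q : ℕ} {A : Ω → Fin p → ℝ} {B : Ω → Fin q → ℝ}
    (hA : ∀ a, MemLp (fun ω => A ω a) 2 P) (hB : ∀ u, MemLp (fun ω => B ω u) 2 P)
    (β : Fin q → ℝ) (a : Fin p) :
    (crossCov P A B *ᵥ β) a = cov[fun ω => A ω a, fun ω => B ω ⬝ᵥ β; P] := by
  simp only [Matrix.mulVec, dotProduct, crossCov, Matrix.of_apply]
  rw [covariance_fun_sum_right (fun u => (hB u).mul_const (β u)) (hA a)]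
  exact Finset.sum_congr rfl fun u _ => (covariance_mul_const_right _).symm

/-- The noise `Y - V` has mean zero, and pulling the `I`-measurable factor `I ω a` out of the
conditional expectation makes it orthogonal to `I`. So its covariance with `I` vanishes. -/
lemma covariance_eq_of_condExp_eq_zero [IsProbabilityMeasure P] {p : ℕ}
    {I : Ω → Fin p → ℝ} (hI : Measurable I)
    (hI2 : ∀ a, MemLp (fun ω => I ω a) 2 P) {Y V : Ω → ℝ} (hY : MemLp Y 2 P) (hV : MemLp V 2 P)
    (hexo : P[fun ω => Y ω - V ω | MeasurableSpace.comap I inferInstance] =ᵐ[P] 0) (a : Fin p) :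
    cov[fun ω => I ω a, Y; P] = cov[fun ω => I ω a, V; P] := by
  have hm : MeasurableSpace.comap I inferInstance ≤ ‹MeasurableSpace Ω› := hI.comap_le
  have hε : MemLp (fun ω => Y ω - V ω) 2 P := hY.sub hV
  have h1 : ∫ ω, Y ω - V ω ∂P = 0 := by
    rw [← integral_condExp hm, integral_congr_ae hexo]
    simp
  have hIa : StronglyMeasurable[MeasurableSpace.comap I inferInstance] fun ω => I ω a :=
    ((measurable_pi_apply a).comp (comap_measurable I)).stronglyMeasurable
  have h2 : ∫ ω, I ω a * (Y ω - V ω) ∂P = 0 := by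
    have h3 := condExp_mul_of_stronglyMeasurable_left hIa ((hI2 a).integrable_mul hε)
      (hε.integrable (by norm_num))
    have h4 : P[(fun ω => I ω a) * fun ω => Y ω - V ω |
        MeasurableSpace.comap I inferInstance] =ᵐ[P] 0 := by
      filter_upwards [h3, hexo] with ω h5 h6
      rw [h5, Pi.mul_apply, h6]
      simp
    have h5 := integral_condExp (f := (fun ω => I ω a) * fun ω => Y ω - V ω) (μ := P) hm
    rw [integral_congr_ae h4] at h5
    simpa using h5.symm
  have h3 : cov[fun ω => I ω a, fun ω => Y ω - V ω; P] = 0 := by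
    rw [covariance_eq_sub (hI2 a) hε, h1, mul_zero, sub_zero]
    exact h2
  rw [covariance_fun_sub_right (hI2 a) hY hV] at h3
  linarith

end Exogeneity

/-! ### Asymptotic linearity of the estimators. -/

section Assembly

variable {Ω : Type*} [MeasurableSpace Ω] {P : Measure Ω} {m d : ℕ}

/-- The factor `r` is spent on one copy of the moments, keeping it bounded in probability, while the
other copy tends to zero. With `r = √N` the criterion at `β` is of smaller order than the penalty
level. -/
lemma tendsto_mul_gmmObjective {W : ℕ × Ω → Matrix (Fin m) (Fin m) ℝ}
    {W₀ : Matrix (Fin m) (Fin m) ℝ} (hW : Tendsto W (probFilter P) (𝓝 W₀))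
    {a : ℕ → Ω → Fin m → ℝ} {B : ℕ → Ω → Matrix (Fin m) (Fin d) ℝ} {β : Fin d → ℝ}
    (hg : Tendsto (fun x : ℕ × Ω => a x.1 x.2 - B x.1 x.2 *ᵥ β) (probFilter P) (𝓝 0))
    {r : ℕ → ℝ} (hbdd : ∀ i, BddInProb P fun k ω => r k * (a k ω - B k ω *ᵥ β) i) :
    Tendsto (fun x : ℕ × Ω => r x.1 * gmmObjective (W x) (a x.1 x.2) (B x.1 x.2) β)
      (probFilter P) (𝓝 0) := by
  have h1 : ∀ i, Tendsto (fun x : ℕ × Ω => (W x *ᵥ (a x.1 x.2 - B x.1 x.2 *ᵥ β)) i)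
      (probFilter P) (𝓝 0) := by
    intro i
    have h0 : (0 : ℝ) = ∑ j, W₀ i j * (0 : Fin m → ℝ) j := by simp
    rw [h0]
    exact tendsto_finsetSum _ fun j _ =>
      (tendsto_pi_nhds.1 (tendsto_pi_nhds.1 hW i) j).mul (tendsto_pi_nhds.1 hg j)
  have h2 := tendsto_finsetSum Finset.univ fun i _ =>
    (hbdd i).tendsto_mul (h := fun k ω => (W (k, ω) *ᵥ (a k ω - B k ω *ᵥ β)) i) (h1 i)
  simp only [Finset.sum_const_zero] at h2
  refine h2.congr fun x => ?_
  rw [gmmObjective, dotProduct, Finset.mul_sum]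
  exact Finset.sum_congr rfl fun i _ => by ring

/-- Linearization of the refitted estimator. -/
lemma tendsto_linearization {N : ℕ → ℕ} {a : ℕ → Ω → Fin m → ℝ}
    {B : ℕ → Ω → Matrix (Fin m) (Fin d) ℝ} {β : Fin d → ℝ} {b : ℕ → Ω → Fin d → ℝ}
    {G : ℕ × Ω → Matrix (Fin d) (Fin m) ℝ} {G₀ : Matrix (Fin d) (Fin m) ℝ}
    (hG : Tendsto G (probFilter P) (𝓝 G₀))
    (hb : ∀ᶠ x in probFilter P, b x.1 x.2 - β = G x *ᵥ (a x.1 x.2 - B x.1 x.2 *ᵥ β))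
    (hbdd : ∀ i, BddInProb P fun k ω => √(N k : ℝ) * (a k ω - B k ω *ᵥ β) i)
    (s : Fin d → ℝ) :
    Tendsto (fun x : ℕ × Ω => √(N x.1 : ℝ) * (s ⬝ᵥ (b x.1 x.2 - β)) -
      √(N x.1 : ℝ) * ((G₀ᵀ *ᵥ s) ⬝ᵥ (a x.1 x.2 - B x.1 x.2 *ᵥ β))) (probFilter P) (𝓝 0) := by
  have h1 : ∀ i, Tendsto (fun x : ℕ × Ω => ((G x - G₀)ᵀ *ᵥ s) i) (probFilter P) (𝓝 0) := by
    intro i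
    have h0 : (0 : ℝ) = ∑ j, (G₀ j i - G₀ j i) * s j := by simp
    rw [h0]
    exact tendsto_finsetSum _ fun j _ =>
      ((tendsto_pi_nhds.1 (tendsto_pi_nhds.1 hG j) i).sub_const _).mul_const _
  have h2 := tendsto_finsetSum Finset.univ fun i _ =>
    (hbdd i).tendsto_mul (h := fun k ω => ((G (k, ω) - G₀)ᵀ *ᵥ s) i) (h1 i)
  simp only [Finset.sum_const_zero] at h2
  refine h2.congr' ?_
  filter_upwards [hb] with x hx
  have h3 : ∀ M : Matrix (Fin d) (Fin m) ℝ, ∀ v, s ⬝ᵥ (M *ᵥ v) = (Mᵀ *ᵥ s) ⬝ᵥ v := fun M v => by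
    rw [Matrix.dotProduct_mulVec, Matrix.mulVec_transpose]
  rw [hx, h3, ← mul_sub, ← sub_dotProduct, ← Matrix.sub_mulVec, ← Matrix.transpose_sub,
    dotProduct, Finset.mul_sum]
  exact Finset.sum_congr rfl fun i _ => by ring

lemma mem_waldInterval_iff {z : ℝ} {N : ℕ} (hN : 0 < N) (b : Fin d → ℝ)
    (V : Matrix (Fin d) (Fin d) ℝ) (j : Fin d) (r : ℝ) :
    r ∈ waldInterval z N b V j ↔ |√(N : ℝ) * (b j - r)| ≤ z * √(V j j) := by
  have h0 : (0 : ℝ) < √(N : ℝ) := Real.sqrt_pos.2 (by exact_mod_cast hN)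
  rw [waldInterval, Set.mem_Icc, Real.sqrt_div' _ (Nat.cast_nonneg N), abs_mul, abs_of_pos h0,
    mul_comm √(N : ℝ), ← le_div_iff₀ h0, mul_div_assoc, abs_le]
  constructor
  · rintro ⟨h1, h2⟩
    exact ⟨by linarith, by linarith⟩
  · rintro ⟨h1, h2⟩
    exact ⟨by linarith, by linarith⟩

end Assembly

/-! ### Support recovery and oracle properties in terms of abstract sample moments. -/

section Assembly

variable {Ω : Type*} [MeasurableSpace Ω] {P : Measure Ω} {m d : ℕ}

lemma tendsto_sub_mulVec {a : ℕ → Ω → Fin m → ℝ} {B : ℕ → Ω → Matrix (Fin m) (Fin d) ℝ}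
    {C : Matrix (Fin m) (Fin d) ℝ} {β : Fin d → ℝ}
    (ha : Tendsto (fun x : ℕ × Ω => a x.1 x.2) (probFilter P) (𝓝 (C *ᵥ β)))
    (hB : Tendsto (fun x : ℕ × Ω => B x.1 x.2) (probFilter P) (𝓝 C)) :
    Tendsto (fun x : ℕ × Ω => a x.1 x.2 - B x.1 x.2 *ᵥ β) (probFilter P) (𝓝 0) := by
  have h := ha.sub (tendsto_mulVec hB (tendsto_const_nhds (x := β)))
  rwa [sub_self] at h

/-- With a penalty of order `N^{-1/2}` and root-`N` consistent sample moments, thresholding the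
penalized estimator recovers the support with probability tending to one. -/
lemma eventually_selected_lasso_eq {N : ℕ → ℕ} (hN : Tendsto N atTop atTop)
    {a : ℕ → Ω → Fin m → ℝ} {B : ℕ → Ω → Matrix (Fin m) (Fin d) ℝ}
    {C : Matrix (Fin m) (Fin d) ℝ} {β : Fin d → ℝ}
    (ha : Tendsto (fun x : ℕ × Ω => a x.1 x.2) (probFilter P) (𝓝 (C *ᵥ β)))
    (hB : Tendsto (fun x : ℕ × Ω => B x.1 x.2) (probFilter P) (𝓝 C))
    (hbdd : ∀ i, BddInProb P fun k ω => √(N k : ℝ) * (a k ω - B k ω *ᵥ β) i)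
    {W : ℕ → Ω → Matrix (Fin m) (Fin m) ℝ} {W₀ : Matrix (Fin m) (Fin m) ℝ}
    (hWpos : ∀ k, ∀ᵐ ω ∂P, (W k ω).PosDef)
    (hW : Tendsto (fun x : ℕ × Ω => W x.1 x.2) (probFilter P) (𝓝 W₀))
    (hRE : RestrictedEigenvalue C W₀ (supp β).card)
    {lam : ℕ → ℝ} (hlam : ∀ k, 0 < lam k) (hlamΘ : lam =Θ[atTop] fun k => 1 / √(N k : ℝ))
    {lasso : ℕ → Ω → Fin d → ℝ}
    (hlasso : ∀ k, ∀ᵐ ω ∂P, IsLassoGMM (W k ω) (a k ω) (B k ω) (lam k) (lasso k ω))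
    {c : ℝ} (hc : 0 < c) (hbetamin : ∀ j ∈ supp β, c ≤ |β j|) :
    ∀ᶠ x in probFilter P, selected c (lasso x.1 x.2) = supp β := by
  have hlam0 : Tendsto lam atTop (𝓝 0) := by
    refine hlamΘ.1.trans_tendsto ?_
    simp only [one_div]
    exact (Real.tendsto_sqrt_atTop.comp
      (tendsto_natCast_atTop_atTop.comp hN)).inv_tendsto_atTop
  have hQ : Tendsto (fun x : ℕ × Ω => (lam x.1)⁻¹ *
      gmmObjective (W x.1 x.2) (a x.1 x.2) (B x.1 x.2) β) (probFilter P) (𝓝 0) := by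
    -- The lower half of the exact order, `1 / √N ≤ K * lam`, bounds `lam⁻¹` by `K √N`; the upper
    -- half was used for `hlam0`.
    obtain ⟨K, hK, hKle⟩ := hlamΘ.2.exists_pos
    have h1 := (tendsto_mul_gmmObjective hW (tendsto_sub_mulVec ha hB) hbdd).const_mul K
    rw [mul_zero] at h1
    refine squeeze_zero' ?_ ?_ h1
    · filter_upwards [eventually_probFilter_of_ae hWpos] with x hx
      exact mul_nonneg (inv_nonneg.2 (hlam x.1).le) (gmmObjective_nonneg hx _ _ _)
    · filter_upwards [eventually_probFilter_of_ae hWpos,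
        tendsto_fst_probFilter.eventually hKle.bound,
        (tendsto_fst_probFilter (P := P)).eventually (hN.eventually_gt_atTop 0)] with x h2 h3 h4
      have h5 : (0 : ℝ) < √(N x.1 : ℝ) := Real.sqrt_pos.2 (by exact_mod_cast h4)
      rw [Real.norm_of_nonneg (by positivity), Real.norm_of_nonneg (hlam x.1).le,
        div_le_iff₀ h5] at h3
      rw [← mul_assoc]
      refine mul_le_mul_of_nonneg_right ?_ (gmmObjective_nonneg h2 _ _ _)
      rw [inv_le_iff_one_le_mul₀ (hlam x.1)]
      linarith
  exact eventually_selected_eq hc hbetamin (tendsto_of_isLassoGMM hRE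
    (fun x : ℕ × Ω => hlam x.1) hW ha hB (eventually_probFilter_of_ae hWpos)
    (hlam0.comp tendsto_fst_probFilter) hQ (eventually_probFilter_of_ae hlasso))

lemma transpose_eq_of_posDef {M : Matrix (Fin m) (Fin m) ℝ} (h : M.PosDef) : Mᵀ = M := by
  rw [← Matrix.conjTranspose_eq_transpose_of_trivial]
  exact h.isHermitian

/-- The determinant of the sample Gram matrix converges to a nonzero limit, so with probability
tending to one the normal equations on the true support are solvable. -/
lemma eventually_refit_sub_eq {a : ℕ → Ω → Fin m → ℝ} {B : ℕ → Ω → Matrix (Fin m) (Fin d) ℝ}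
    {C : Matrix (Fin m) (Fin d) ℝ} {β : Fin d → ℝ}
    (hB : Tendsto (fun x : ℕ × Ω => B x.1 x.2) (probFilter P) (𝓝 C))
    {W' : ℕ → Ω → Matrix (Fin m) (Fin m) ℝ} {W'₀ : Matrix (Fin m) (Fin m) ℝ}
    (hW'pos : ∀ k, ∀ᵐ ω ∂P, (W' k ω).PosDef)
    (hW' : Tendsto (fun x : ℕ × Ω => W' x.1 x.2) (probFilter P) (𝓝 W'₀))
    (hdet : ((cols C (supp β))ᵀ * W'₀ * cols C (supp β)).det ≠ 0)
    {S : ℕ → Ω → Finset (Fin d)} (hsel : ∀ᶠ x in probFilter P, S x.1 x.2 = supp β)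
    {refit : ℕ → Ω → Fin d → ℝ}
    (hrefit : ∀ k, ∀ᵐ ω ∂P, IsRefitGMM (W' k ω) (a k ω) (B k ω) (S k ω) (refit k ω)) :
    ∀ᶠ x in probFilter P, refit x.1 x.2 - β =
      gain (B x.1 x.2) (W' x.1 x.2) (supp β) *ᵥ (a x.1 x.2 - B x.1 x.2 *ᵥ β) := by
  have hdetlim := (continuous_id.matrix_det.tendsto _).comp (tendsto_gram hB hW' (supp β))
  filter_upwards [hsel, eventually_probFilter_of_ae hW'pos, eventually_probFilter_of_ae hrefit,
    hdetlim.eventually_ne hdet] with x h1 h2 h3 h4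
  rw [h1] at h3
  exact sub_eq_gain_mulVec_of_isRefitGMM (transpose_eq_of_posDef h2) h3
    (fun j hj => by simpa [supp] using hj) h4

/-- Asymptotic normality of linear combinations of an estimation error that is asymptotically
linear in the sample moments. -/
lemma tendstoInDistribution_sqrt_mul_dotProduct [IsProbabilityMeasure P] {N : ℕ → ℕ} {a : ℕ → Ω → Fin m → ℝ}
    {B : ℕ → Ω → Matrix (Fin m) (Fin d) ℝ} {β : Fin d → ℝ} {b : ℕ → Ω → Fin d → ℝ}
    (hbm : ∀ k, AEMeasurable (b k) P)
    {G : ℕ × Ω → Matrix (Fin d) (Fin m) ℝ} {G₀ : Matrix (Fin d) (Fin m) ℝ}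
    (hG : Tendsto G (probFilter P) (𝓝 G₀))
    (hb : ∀ᶠ x in probFilter P, b x.1 x.2 - β = G x *ᵥ (a x.1 x.2 - B x.1 x.2 *ᵥ β))
    (hbdd : ∀ i, BddInProb P fun k ω => √(N k : ℝ) * (a k ω - B k ω *ᵥ β) i)
    {O : Matrix (Fin m) (Fin m) ℝ}
    (hclt : ∀ t : Fin m → ℝ, TendstoInDistribution
      (fun k ω => √(N k : ℝ) * (t ⬝ᵥ (a k ω - B k ω *ᵥ β))) atTop
      (id : ℝ → ℝ) (fun _ => P) (gaussianReal 0 (t ⬝ᵥ (O *ᵥ t)).toNNReal))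
    (s : Fin d → ℝ) :
    TendstoInDistribution (fun k ω => √(N k : ℝ) * (s ⬝ᵥ (b k ω - β))) atTop
      (id : ℝ → ℝ) (fun _ => P) (gaussianReal 0 (s ⬝ᵥ ((G₀ * O * G₀ᵀ) *ᵥ s)).toNNReal) := by
  have h1 : s ⬝ᵥ ((G₀ * O * G₀ᵀ) *ᵥ s) = (G₀ᵀ *ᵥ s) ⬝ᵥ (O *ᵥ (G₀ᵀ *ᵥ s)) := by
    rw [← Matrix.mulVec_mulVec, ← Matrix.mulVec_mulVec, Matrix.dotProduct_mulVec,
      Matrix.mulVec_transpose]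
  rw [h1]
  refine tendstoInDistribution_of_tendstoInMeasure_sub _ _ (hclt (G₀ᵀ *ᵥ s))
    (tendsto_probFilter_iff_tendstoInMeasure.1 (tendsto_linearization hG hb hbdd s))
    fun k => ?_
  simp only [dotProduct, Pi.sub_apply]
  exact (Finset.aemeasurable_fun_sum _ fun j _ =>
    (((measurable_pi_apply j).comp_aemeasurable (hbm k)).sub_const _).const_mul _).const_mul _

/-- Oracle properties of the estimator refitted on a consistently selected support: asymptotic
normality, and coverage of the Wald intervals with plug-in standard errors. -/
theorem refit_oracle_properties [IsProbabilityMeasure P] {N : ℕ → ℕ} (hN : Tendsto N atTop atTop)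
    {a : ℕ → Ω → Fin m → ℝ} {B : ℕ → Ω → Matrix (Fin m) (Fin d) ℝ}
    {C : Matrix (Fin m) (Fin d) ℝ} {β : Fin d → ℝ}
    (ha : Tendsto (fun x : ℕ × Ω => a x.1 x.2) (probFilter P) (𝓝 (C *ᵥ β)))
    (hB : Tendsto (fun x : ℕ × Ω => B x.1 x.2) (probFilter P) (𝓝 C))
    (hbdd : ∀ i, BddInProb P fun k ω => √(N k : ℝ) * (a k ω - B k ω *ᵥ β) i)
    {O : Matrix (Fin m) (Fin m) ℝ} (hOpos : O.PosSemidef)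
    (hclt : ∀ t : Fin m → ℝ, TendstoInDistribution
      (fun k ω => √(N k : ℝ) * (t ⬝ᵥ (a k ω - B k ω *ᵥ β))) atTop
      (id : ℝ → ℝ) (fun _ => P) (gaussianReal 0 (t ⬝ᵥ (O *ᵥ t)).toNNReal))
    {W' : ℕ → Ω → Matrix (Fin m) (Fin m) ℝ} {W'₀ : Matrix (Fin m) (Fin m) ℝ}
    (hW'pos : ∀ k, ∀ᵐ ω ∂P, (W' k ω).PosDef) (hW'₀ : W'₀.PosDef)
    (hW' : Tendsto (fun x : ℕ × Ω => W' x.1 x.2) (probFilter P) (𝓝 W'₀))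
    (hdet : ((cols C (supp β))ᵀ * W'₀ * cols C (supp β)).det ≠ 0)
    {S : ℕ → Ω → Finset (Fin d)} (hsel : ∀ᶠ x in probFilter P, S x.1 x.2 = supp β)
    {refit : ℕ → Ω → Fin d → ℝ} (hrefitMeas : ∀ k, AEMeasurable (refit k) P)
    (hrefit : ∀ k, ∀ᵐ ω ∂P, IsRefitGMM (W' k ω) (a k ω) (B k ω) (S k ω) (refit k ω))
    {Ohat : ℕ → Ω → Matrix (Fin m) (Fin m) ℝ}
    (hOhat : Tendsto (fun x : ℕ × Ω => refit x.1 x.2) (probFilter P) (𝓝 β) →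
      Tendsto (fun x : ℕ × Ω => Ohat x.1 x.2) (probFilter P) (𝓝 O)) :
    TendstoInDistribution
      (fun k ω => √(N k : ℝ) • WithLp.toLp 2 (refit k ω - β)) atTop
      (id : EuclideanSpace ℝ (Fin d) → EuclideanSpace ℝ (Fin d)) (fun _ => P)
      (multivariateGaussian 0 (embedBlock (supp β) (sandwich C W'₀ O (supp β)))) ∧
    ∀ α ∈ Set.Ioo (0 : ℝ) 1, ∀ z : ℝ, (gaussianReal 0 1).real (Set.Iic z) = 1 - α / 2 →
      ∀ j, 0 < embedBlock (supp β) (sandwich C W'₀ O (supp β)) j j →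
        Tendsto (fun k => P.real {ω | β j ∈ waldInterval z (N k) (refit k ω)
          (embedBlock (S k ω) (sandwich (B k ω) (W' k ω) (Ohat k ω) (S k ω))) j})
          atTop (𝓝 (1 - α)) := by
  have hG := tendsto_gain hB hW' hdet
  have hlin := eventually_refit_sub_eq hB hW'pos hW' hdet hsel hrefit
  rw [embedBlock_sandwich C (transpose_eq_of_posDef hW'₀)]
  have hscal := tendstoInDistribution_sqrt_mul_dotProduct hrefitMeas hG hlin hbdd hclt
  set G₀ := gain C W'₀ (supp β) with hG₀
  constructor
  · refine tendstoInDistribution_multivariateGaussian (fun k => ?_) ?_ fun s => ?_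
    · have h := (WithLp.measurable_toLp 2 (Fin d → ℝ)).comp_aemeasurable
        ((hrefitMeas k).sub_const β)
      exact h.const_smul √(N k : ℝ)
    · have h := hOpos.mul_mul_conjTranspose_same G₀
      rwa [Matrix.conjTranspose_eq_transpose_of_trivial] at h
    · simpa only [WithLp.ofLp_smul, dotProduct_smul, smul_eq_mul] using hscal s
  intro α hα z hz j hj
  -- Consistency follows from the linear representation: the gain converges and the moments tend to
  -- zero. It has to come before `hOhat`, because the moment variance is estimated at the refitted
  -- coefficients.
  have hrefit0 : Tendsto (fun x : ℕ × Ω => refit x.1 x.2) (probFilter P) (𝓝 β) := by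
    have h2 := (tendsto_mulVec hG (tendsto_sub_mulVec ha hB)).add_const β
    rw [Matrix.mulVec_zero, zero_add] at h2
    refine h2.congr' ?_
    filter_upwards [hlin] with x hx
    rw [← hx, sub_add_cancel]
  have hOlim := hOhat hrefit0
  have hVhat : Tendsto (fun x : ℕ × Ω => (gain (B x.1 x.2) (W' x.1 x.2) (supp β) * Ohat x.1 x.2 *
      (gain (B x.1 x.2) (W' x.1 x.2) (supp β))ᵀ) j j) (probFilter P)
      (𝓝 ((G₀ * O * G₀ᵀ) j j)) := tendsto_pi_nhds.1 (tendsto_pi_nhds.1 (tendsto_matrix_mul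
    (tendsto_matrix_mul hG hOlim) (tendsto_transpose hG)) j) j
  have hTj := hscal (Pi.single j 1)
  rw [single_one_dotProduct, Matrix.mulVec_single_one] at hTj
  refine tendsto_measureReal_coverage hj hTj hVhat hα hz ?_
  -- Where the selected support is the true one, the reported variance is the gain sandwich on a
  -- fixed support, whose limit is `hVhat`.
  filter_upwards [hsel, eventually_probFilter_of_ae hW'pos,
    (tendsto_fst_probFilter (P := P)).eventually (hN.eventually_gt_atTop 0)] with x h1 h2 h3
  rw [single_one_dotProduct, Pi.sub_apply, mem_waldInterval_iff h3, h1,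
    embedBlock_sandwich _ (transpose_eq_of_posDef h2)]

end Assembly

end UnpairedIV

/-! ### The oracle theorem for the two-sample model. -/

open UnpairedIV in
/-- `(I, X, Y)` and `(It, Xt)` are the population variables; `Is, Ys` and `Its, Xts` are the two
observed samples. The `k`-th data set has sizes `n k` and `nt k`, with `N = n k + nt k`. -/
theorem mainTheorem4 {Ω : Type*} [MeasurableSpace Ω] (P : Measure Ω) [IsProbabilityMeasure P]
    {m d : ℕ}
    -- population variables
    (I : Ω → Fin m → ℝ) (X : Ω → Fin d → ℝ) (Y : Ω → ℝ)
    (It : Ω → Fin m → ℝ) (Xt : Ω → Fin d → ℝ) (β : Fin d → ℝ)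
    (hI : Measurable I) (hX : Measurable X) (hY : Measurable Y)
    (hIt : Measurable It) (hXt : Measurable Xt)
    (hI4 : MemLp I 4 P) (hX2 : MemLp X 2 P) (hY4 : MemLp Y 4 P)
    (hIt4 : MemLp It 4 P) (hXt4 : MemLp Xt 4 P)
    -- equality of the cross-covariances, and exogeneity of the noise `Y - Xᵀ β`
    (hcov : crossCov P It Xt = crossCov P I X)
    (hexo : P[fun ω => Y ω - X ω ⬝ᵥ β | MeasurableSpace.comap I inferInstance] =ᵐ[P] 0)
    -- the two i.i.d. samples, independent of each other
    (Is : ℕ → Ω → Fin m → ℝ) (Ys : ℕ → Ω → ℝ)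
    (Its : ℕ → Ω → Fin m → ℝ) (Xts : ℕ → Ω → Fin d → ℝ)
    (hIs : ∀ i, Measurable (Is i)) (hYs : ∀ i, Measurable (Ys i))
    (hIts : ∀ i, Measurable (Its i)) (hXts : ∀ i, Measurable (Xts i))
    (hid : ∀ i, IdentDistrib (fun ω => (Is i ω, Ys i ω)) (fun ω => (I ω, Y ω)) P P)
    (hindep : iIndepFun (fun i ω => (Is i ω, Ys i ω)) P)
    (hidt : ∀ i, IdentDistrib (fun ω => (Its i ω, Xts i ω)) (fun ω => (It ω, Xt ω)) P P)
    (hindept : iIndepFun (fun i ω => (Its i ω, Xts i ω)) P)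
    (hindep2 : IndepFun (fun ω (i : ℕ) => (Is i ω, Ys i ω)) (fun ω (i : ℕ) => (Its i ω, Xts i ω)) P)
    -- centring: by the sample means, or not at all if the population means vanish
    (cen : Centering)
    (hcen : cen = Centering.population →
      (∫ ω, I ω ∂P) = 0 ∧ (∫ ω, Y ω ∂P) = 0 ∧ (∫ ω, It ω ∂P) = 0 ∧ (∫ ω, Xt ω ∂P) = 0)
    -- sample sizes
    (n nt : ℕ → ℕ) (τ τt : ℝ)
    (hn : Tendsto n atTop atTop) (hnt : Tendsto nt atTop atTop)
    (hτ : τ ∈ Set.Ioo (0 : ℝ) 1) (hτt : τt ∈ Set.Ioo (0 : ℝ) 1)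
    (hτlim : Tendsto (fun k => (n k : ℝ) / ((n k + nt k : ℕ) : ℝ)) atTop (𝓝 τ))
    (hτtlim : Tendsto (fun k => (nt k : ℝ) / ((n k + nt k : ℕ) : ℝ)) atTop (𝓝 τt))
    -- first weight sequence and the restricted eigenvalue condition
    (W : ℕ → Ω → Matrix (Fin m) (Fin m) ℝ) (W₀ : Matrix (Fin m) (Fin m) ℝ)
    (hWmeas : ∀ k a b, AEMeasurable (fun ω => W k ω a b) P)
    (hWpos : ∀ k, ∀ᵐ ω ∂P, (W k ω).PosDef) (hW₀ : W₀.PosDef)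
    (hWlim : ∀ a b, TendstoInMeasure P (fun k ω => W k ω a b) atTop fun _ => W₀ a b)
    (hRE : RestrictedEigenvalue (crossCov P It Xt) W₀ (supp β).card)
    -- penalty of exact order `N^{-1/2}`, the Lasso-GMM, and the beta-min condition
    (lam : ℕ → ℝ) (hlam : ∀ k, 0 < lam k)
    (hlamΘ : lam =Θ[atTop] fun k => 1 / √((n k + nt k : ℕ) : ℝ))
    (lasso : ℕ → Ω → Fin d → ℝ) (hlassoMeas : ∀ k, AEMeasurable (lasso k) P)
    (hlasso : ∀ k, ∀ᵐ ω ∂P, IsLassoGMM (W k ω)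
      (sampleCovVec cen (n k) (fun i => Is i ω) (fun i => Ys i ω))
      (sampleCovMat cen (nt k) (fun i => Its i ω) (fun i => Xts i ω)) (lam k) (lasso k ω))
    (c : ℝ) (hc : 0 < c) (hbetamin : ∀ j ∈ supp β, c ≤ |β j|)
    -- second weight sequence and the refitted estimator on the selected support
    (W' : ℕ → Ω → Matrix (Fin m) (Fin m) ℝ) (W'₀ : Matrix (Fin m) (Fin m) ℝ)
    (hW'meas : ∀ k a b, AEMeasurable (fun ω => W' k ω a b) P)
    (hW'pos : ∀ k, ∀ᵐ ω ∂P, (W' k ω).PosDef) (hW'₀ : W'₀.PosDef)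
    (hW'lim : ∀ a b, TendstoInMeasure P (fun k ω => W' k ω a b) atTop fun _ => W'₀ a b)
    (refit : ℕ → Ω → Fin d → ℝ) (hrefitMeas : ∀ k, AEMeasurable (refit k) P)
    (hrefit : ∀ k, ∀ᵐ ω ∂P, IsRefitGMM (W' k ω)
      (sampleCovVec cen (n k) (fun i => Is i ω) (fun i => Ys i ω))
      (sampleCovMat cen (nt k) (fun i => Its i ω) (fun i => Xts i ω))
      (selected c (lasso k ω)) (refit k ω)) :
    -- asymptotic normality with the sandwich covariance
    TendstoInDistribution
      (fun k ω => √((n k + nt k : ℕ) : ℝ) • WithLp.toLp 2 (refit k ω - β)) atTop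
      (id : EuclideanSpace ℝ (Fin d) → EuclideanSpace ℝ (Fin d)) (fun _ => P)
      (multivariateGaussian 0 (embedBlock (supp β)
        (sandwich (crossCov P I X) W'₀ (momentVar P τ τt I Y It Xt β) (supp β)))) ∧
    -- asymptotic coverage of the Wald intervals with plug-in standard errors
    ∀ α ∈ Set.Ioo (0 : ℝ) 1, ∀ z : ℝ, (gaussianReal 0 1).real (Set.Iic z) = 1 - α / 2 →
      ∀ j, 0 < embedBlock (supp β)
          (sandwich (crossCov P I X) W'₀ (momentVar P τ τt I Y It Xt β) (supp β)) j j →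
        Tendsto (fun k => P.real {ω | β j ∈ waldInterval z (n k + nt k) (refit k ω)
          (embedBlock (selected c (lasso k ω))
            (sandwich (sampleCovMat cen (nt k) (fun i => Its i ω) (fun i => Xts i ω)) (W' k ω)
              (sampleMomentVar cen (n k) (nt k) (fun i => Is i ω) (fun i => Ys i ω)
                (fun i => Its i ω) (fun i => Xts i ω) (refit k ω))
              (selected c (lasso k ω)))) j}) atTop (𝓝 (1 - α)) := by
  have hI4' : ∀ a, MemLp (fun ω => I ω a) 4 P := hI4.eval
  have hX2' : ∀ u, MemLp (fun ω => X ω u) 2 P := hX2.eval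
  have hIt4' : ∀ a, MemLp (fun ω => It ω a) 4 P := hIt4.eval
  have hXt4' : ∀ u, MemLp (fun ω => Xt ω u) 4 P := hXt4.eval
  have h42 : ∀ {F : Ω → ℝ}, MemLp F 4 P → MemLp F 2 P := fun h => h.mono_exponent (by norm_num)
  have h41 : ∀ {F : Ω → ℝ}, MemLp F 4 P → Integrable F P := fun h => h.integrable (by norm_num)
  have hXβ2 : MemLp (fun ω => X ω ⬝ᵥ β) 2 P := by
    simp only [dotProduct]
    exact memLp_finsetSum _ fun u _ => (hX2' u).mul_const (β u)
  have hXtβ4 : MemLp (fun ω => Xt ω ⬝ᵥ β) 4 P := by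
    simp only [dotProduct]
    exact memLp_finsetSum _ fun u _ => (hXt4' u).mul_const (β u)
  -- the population means under the first centring convention
  have hcI : cen = Centering.population → ∀ a, ∫ ω, I ω a ∂P = 0 := fun h a => by
    rw [← eval_integral (fun a => h41 (hI4' a)), (hcen h).1, Pi.zero_apply]
  have hcY : cen = Centering.population → ∫ ω, Y ω ∂P = 0 := fun h => (hcen h).2.1
  have hcIt : cen = Centering.population → ∀ a, ∫ ω, It ω a ∂P = 0 := fun h a => by
    rw [← eval_integral (fun a => h41 (hIt4' a)), (hcen h).2.2.1, Pi.zero_apply]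
  have hcXt : cen = Centering.population → ∀ u, ∫ ω, Xt ω u ∂P = 0 := fun h u => by
    rw [← eval_integral (fun u => h41 (hXt4' u)), (hcen h).2.2.2, Pi.zero_apply]
  have hcXtβ : cen = Centering.population → ∫ ω, Xt ω ⬝ᵥ β ∂P = 0 := fun h => by
    simp only [dotProduct]
    rw [integral_finsetSum _ fun u _ => (h41 (hXt4' u)).mul_const (β u)]
    exact Finset.sum_eq_zero fun u _ => by rw [integral_mul_const, hcXt h u, zero_mul]
  -- the moment condition
  have hmomt : ∀ a, ∫ ω, centeredProduct P It (fun ω => Xt ω ⬝ᵥ β) ω a ∂P =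
      (crossCov P It Xt *ᵥ β) a := fun a => by
    rw [integral_centeredProduct,
      crossCov_mulVec_apply (fun a => h42 (hIt4' a)) (fun u => h42 (hXt4' u))]
  -- Exogeneity replaces `Y` by `Xᵀ β`, and the equality of cross-covariances moves the result to
  -- the second population, so both samples estimate the same moment.
  have hmom : ∀ a, ∫ ω, centeredProduct P I Y ω a ∂P = (crossCov P It Xt *ᵥ β) a := fun a => by
    rw [integral_centeredProduct, hcov,
      crossCov_mulVec_apply (fun a => h42 (hI4' a)) hX2',
      covariance_eq_of_condExp_eq_zero hI (fun a => h42 (hI4' a)) (h42 hY4) hXβ2 hexo a]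
  have hOpos : (momentVar P τ τt I Y It Xt β).PosSemidef :=
    ((posSemidef_crossCov (memLp_two_centeredProduct hI4' hY4)).smul
      (inv_nonneg.2 hτ.1.le)).add
      ((posSemidef_crossCov (memLp_two_centeredProduct hIt4' hXtβ4)).smul
        (inv_nonneg.2 hτt.1.le))
  -- laws of large numbers
  have hB : Tendsto (fun x : ℕ × Ω => sampleCovMat cen (nt x.1) (fun i => Its i x.2)
      (fun i => Xts i x.2)) (probFilter P) (𝓝 (crossCov P It Xt)) :=
    tendsto_sampleCovMat (E := (Fin m → ℝ) × (Fin d → ℝ))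
      (Z := fun i ω => (Its i ω, Xts i ω)) (Z₀ := fun ω => (It ω, Xt ω))
      hidt hindept hnt (A := Prod.fst)
      (B := Prod.snd) (fun a => by fun_prop) (fun u => by fun_prop) hIt4' hXt4' hcIt hcXt
  have ha : Tendsto (fun x : ℕ × Ω => sampleCovVec cen (n x.1) (fun i => Is i x.2)
      (fun i => Ys i x.2)) (probFilter P) (𝓝 (crossCov P It Xt *ᵥ β)) := by
    refine tendsto_pi_nhds.2 fun i => ?_
    have h := tendsto_avg_sampleProduct (E := (Fin m → ℝ) × ℝ)
      (Z := fun i ω => (Is i ω, Ys i ω)) (Z₀ := fun ω => (I ω, Y ω))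
      hid hindep hn (A := Prod.fst)
      (b := Prod.snd) (fun a => by fun_prop) measurable_snd hI4' hY4 hcI hcY i
    rw [← hmom]
    simpa only [sampleCovVec, avg_apply] using h
  have hW : Tendsto (fun x : ℕ × Ω => W x.1 x.2) (probFilter P) (𝓝 W₀) :=
    tendsto_pi_nhds.2 fun i => tendsto_pi_nhds.2 fun j =>
      (tendsto_probFilter_iff_tendstoInMeasure (f := fun k ω => W k ω i j)).2 (hWlim i j)
  have hW' : Tendsto (fun x : ℕ × Ω => W' x.1 x.2) (probFilter P) (𝓝 W'₀) :=
    tendsto_pi_nhds.2 fun i => tendsto_pi_nhds.2 fun j =>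
      (tendsto_probFilter_iff_tendstoInMeasure (f := fun k ω => W' k ω i j)).2 (hW'lim i j)
  -- central limit theorem for the sample moments
  have hclt : ∀ t : Fin m → ℝ, TendstoInDistribution
      (fun k ω => √((n k + nt k : ℕ) : ℝ) * (t ⬝ᵥ
        (sampleCovVec cen (n k) (fun i => Is i ω) (fun i => Ys i ω) -
          sampleCovMat cen (nt k) (fun i => Its i ω) (fun i => Xts i ω) *ᵥ β))) atTop
      (id : ℝ → ℝ) (fun _ => P)
      (gaussianReal 0 (t ⬝ᵥ (momentVar P τ τt I Y It Xt β *ᵥ t)).toNNReal) := by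
    intro t
    simp only [sampleCovMat_mulVec]
    exact tendstoInDistribution_sampleCovVec_sub (E := (Fin m → ℝ) × ℝ)
      (E' := (Fin m → ℝ) × (Fin d → ℝ)) (Z := fun i ω => (Is i ω, Ys i ω))
      (Z₀ := fun ω => (I ω, Y ω)) (Z' := fun i ω => (Its i ω, Xts i ω))
      (Z₀' := fun ω => (It ω, Xt ω)) hid hindep hidt hindept hindep2
      (A := Prod.fst) (b := Prod.snd) (A' := Prod.fst) (b' := fun z => z.2 ⬝ᵥ β)
      (fun a => by fun_prop) measurable_snd hI4' hY4 (fun a => by fun_prop)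
      (by simp only [dotProduct]; fun_prop) hIt4' hXtβ4 hcI hcY hcIt hcXtβ
      (fun i => (hmom i).trans (hmomt i).symm) hn hnt hτ.1 hτt.1 hτlim hτtlim t
  have hbdd : ∀ i, BddInProb P fun k ω => √((n k + nt k : ℕ) : ℝ) *
      (sampleCovVec cen (n k) (fun i => Is i ω) (fun i => Ys i ω) -
        sampleCovMat cen (nt k) (fun i => Its i ω) (fun i => Xts i ω) *ᵥ β) i := fun i => by
    -- Root-`N` boundedness of each moment is the tightness contained in the central limit theorem
    -- for a coordinate direction.
    have h := bddInProb_of_tendstoInDistribution (hclt (Pi.single i 1))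
    simpa only [single_one_dotProduct] using h
  have hN : Tendsto (fun k => n k + nt k) atTop atTop := tendsto_atTop_mono (fun k => Nat.le_add_right _ _) hn
  have hsel := eventually_selected_lasso_eq (N := fun k => n k + nt k)
    (a := fun k ω => sampleCovVec cen (n k) (fun i => Is i ω) (fun i => Ys i ω))
    (B := fun k ω => sampleCovMat cen (nt k) (fun i => Its i ω) (fun i => Xts i ω))
    hN ha hB hbdd hWpos hW hRE hlam hlamΘ hlasso hc
    hbetamin
  have hdet := hRE.det_gram_ne_zero hW'₀
  rw [← hcov]
  refine refit_oracle_properties (N := fun k => n k + nt k)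
    (a := fun k ω => sampleCovVec cen (n k) (fun i => Is i ω) (fun i => Ys i ω))
    (B := fun k ω => sampleCovMat cen (nt k) (fun i => Its i ω) (fun i => Xts i ω))
    (S := fun k ω => selected c (lasso k ω))
    (Ohat := fun k ω => sampleMomentVar cen (n k) (nt k) (fun i => Is i ω) (fun i => Ys i ω)
      (fun i => Its i ω) (fun i => Xts i ω) (refit k ω))
    hN ha hB hbdd hOpos hclt hW'pos hW'₀ hW' hdet hsel hrefitMeas
    hrefit fun hrefit0 => ?_
  have h1 := tendsto_sampleVar (E := (Fin m → ℝ) × ℝ)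
    (Z := fun i ω => (Is i ω, Ys i ω)) (Z₀ := fun ω => (I ω, Y ω))
    hid hindep hn (A := Prod.fst)
    (b := Prod.snd) (fun a => by fun_prop) measurable_snd hI4' hY4 hcI hcY
  have h2 := tendsto_sampleVar_dotProduct (E := (Fin m → ℝ) × (Fin d → ℝ))
    (Z := fun i ω => (Its i ω, Xts i ω)) (Z₀ := fun ω => (It ω, Xt ω))
    hidt hindept hnt
    (A := Prod.fst) (B := Prod.snd) (fun a => by fun_prop) (fun u => by fun_prop) hIt4' hXt4'
    hcIt hcXt hrefit0
  -- The weights `N / n` and `N / nt` converge to `τ⁻¹` and `τt⁻¹`, and the two empirical covariance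
  -- matrices to their population counterparts.
  exact (((hτlim.inv₀ hτ.1.ne').comp tendsto_fst_probFilter).smul h1).add
    (((hτtlim.inv₀ hτt.1.ne').comp tendsto_fst_probFilter).smul h2)
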